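/- Let $(E,H,\mu)$ be an abstract Wiener space: $H$ is a separable real Hilbert space with norm $|\cdot|$, continuously, injectively and densely embedded into a real Banach space $(E,\|\cdot\|)$, and $\mu$ is a measure on the Borel $\sigma$-algebra of $E$ such that every $l\in E'$ is normally distributed under $\mu$ with mean $0$ and variance $|l|^2$, where $E'\subset H'\equiv H\subset E$. Write $\|i\|$ for the operator norm of the embedding $i:H\to E$. Let $x\in E\setminus H$. (a) There is an orthonormal basis $(e_n)_{n\ge1}$ of $H$ with $e_n\in E'$ for all $n$, which separates the points of $E$ and satisfies $e_n(x)\ge 2^{n/2}$ for all $n\ge1$. (b) For every such basis, put $\widetilde P_nz=\sum_{k=1}^n e_k(z)\,e_k$ for $z\in E$. There is a subsequence $\widetilde Q_n=\widetilde P_{\nu_n}$, $1\le\nu_1<\nu_2<\cdots$, such that for all $n\ge1$ $$\|\mathrm{Id}_H-\widetilde Q_n|_H\|_{\mathcal L(H,E)}\le 2^{-n},\qquad \mu\big(\{z\in E:\|z-\widetilde Q_nz\|>2^{-n}\}\big)\le 2^{-n}.$$ For every basis as in (a) and every subsequence as in (b), put $\widetilde Q_0=0$ and define, for $z\in E$,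 $$q_x(z)=\Big[\sum_{n\ge0}2^n\|\widetilde Q_{n+1}z-\widetilde Q_nz\|^2+\Big(\sum_{n\ge1}2^{-n/2}|e_n(z)|\Big)^2\Big]^{1/2}\in[0,\infty],\qquad E_x=\{z\in E:q_x(z)<\infty\}.$$ Then: (i) $E_x$ is a Borel set and $\mu(E_x)=1$. (ii) $q_x(h)\le\sqrt{2+\|i\|^2}\;|h|$ for all $h\in H$; in particular, if the norms are normalized so that $\|h\|\le|h|$ for all $h\in H$, then $q_x(h)\le\sqrt3\,|h|$ for all $h\in H$. Thus $H\subset E_x$ continuously. (iii) $\|z\|\le\sqrt2\,q_x(z)$ for all $z\in E$; $(E_x,q_x)$ is a complete normed space, and it is compactly embedded into $(E,\|\cdot\|)$. (iv) $((E_x,q_x),H,\mu)$, with $\mu$ restricted to $E_x$, is again an abstract Wiener space, and $q_x\in L^2(E,\mu)$. -/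

import Mathlib

open MeasureTheory ProbabilityTheory
open scoped ENNReal NNReal

noncomputable section

namespace AbstractWiener

section General

variable {H E : Type*} [NormedAddCommGroup H] [InnerProductSpace ℝ H] [CompleteSpace H]
  [NormedAddCommGroup E] [NormedSpace ℝ E]

/-- The canonical map `E' → H' ≡ H`: a continuous functional `l` on `E` is restricted to `H`
along `i : H → E`, and identified with an element of `H` by the Riesz theorem. Hence
`⟪dualToH i l, h⟫ = l (i h)` for all `h`. -/
def dualToH (i : H →L[ℝ] E) (l : StrongDual ℝ E) : H :=
  (InnerProductSpace.toDual ℝ H).symm (l.comp i)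

/-- `(E, H, μ)` is an abstract Wiener space: `H` is a separable Hilbert space, continuously,
injectively and densely embedded by `i` into the Banach space `E`, and every `l ∈ E'` is, under
the Borel measure `μ` on `E`, normally distributed with mean zero and variance `|l|²`, where
`|l|` is the norm of `l` as an element of `H`. -/
structure IsAbstractWienerSpace [MeasurableSpace E] [BorelSpace E]
    (i : H →L[ℝ] E) (μ : Measure E) : Prop where
  separable : TopologicalSpace.SeparableSpace H
  complete : CompleteSpace E
  injective : Function.Injective i
  dense : DenseRange i
  gaussian : ∀ l : StrongDual ℝ E, μ.map l = gaussianReal 0 (‖dualToH i l‖₊ ^ 2)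

/-- An orthonormal basis `e₁, e₂, …` of `H` consisting of elements of `E'` that separates the
points of `E`, and such that `e_n(x) ≥ 2^(n/2)` for all `n ≥ 1`.
The functional `e_n` of the mathematical notation is `e (n - 1)` here. -/
structure CarmonaBasis (i : H →L[ℝ] E) (x : E) where
  e : ℕ → StrongDual ℝ E
  orthonormal : Orthonormal ℝ (fun n => dualToH i (e n))
  total : (Submodule.span ℝ (Set.range fun n => dualToH i (e n))).topologicalClosure = ⊤
  separates : ∀ y z : E, (∀ n, e n y = e n z) → y = z
  growth : ∀ n : ℕ, (2 : ℝ) ^ (((n : ℝ) + 1) / 2) ≤ e n x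

namespace CarmonaBasis

variable {i : H →L[ℝ] E} {x : E} (B : CarmonaBasis i x)

/-- `P̃_n z = ∑_{k=1}^n e_k(z) e_k`, as a map from `E` to `H`. -/
def proj (n : ℕ) : E →L[ℝ] H :=
  ∑ k ∈ Finset.range n, (B.e k).smulRight (dualToH i (B.e k))

/-- The strictly increasing `ν` selects a subsequence `Q̃_n = P̃_{ν n}`, `n ≥ 1`, with
`‖Id_H - Q_n‖_{L(H,E)} ≤ 2⁻ⁿ` and `μ(‖z - Q̃_n z‖ > 2⁻ⁿ) ≤ 2⁻ⁿ` for all `n ≥ 1`.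
The normalization `ν 0 = 0` encodes the convention `Q̃_0 = 0`. -/
structure IsAdmissible [MeasurableSpace E] (μ : Measure E) (ν : ℕ → ℕ) : Prop where
  strictMono : StrictMono ν
  zero : ν 0 = 0
  opNorm_le : ∀ n, 1 ≤ n → ‖i - (i.comp (B.proj (ν n))).comp i‖ ≤ (1 / 2 : ℝ) ^ n
  measure_le : ∀ n, 1 ≤ n →
    μ {z | (1 / 2 : ℝ) ^ n < ‖z - i (B.proj (ν n) z)‖} ≤ (1 / 2 : ℝ≥0∞) ^ n

/-- The extended norm `q_x : E → [0, ∞]`,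
`q_x(z) = [∑_{n ≥ 0} 2ⁿ ‖Q̃_{n+1} z - Q̃_n z‖² + (∑_{n ≥ 1} 2^(-n/2) |e_n(z)|)²]^(1/2)`. -/
def q (ν : ℕ → ℕ) (z : E) : ℝ≥0∞ :=
  ((∑' n : ℕ, (2 : ℝ≥0∞) ^ n * ‖i (B.proj (ν (n + 1)) z) - i (B.proj (ν n) z)‖ₑ ^ 2) +
    (∑' n : ℕ, (2 : ℝ≥0∞) ^ (-(((n : ℝ) + 1) / 2)) * ‖B.e n z‖ₑ) ^ 2) ^ (1 / 2 : ℝ)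

/-- The terms whose `ℓ²`-norm is `q_x(z)`. -/
def qTerm (ν : ℕ → ℕ) (z : E) : ℕ → ℝ≥0∞
  | 0 => ∑' n : ℕ, (2 : ℝ≥0∞) ^ (-(((n : ℝ) + 1) / 2)) * ‖B.e n z‖ₑ
  | n + 1 => (2 : ℝ≥0∞) ^ ((n : ℝ) / 2) * ‖i (B.proj (ν (n + 1)) z) - i (B.proj (ν n) z)‖ₑ

lemma q_eq (ν : ℕ → ℕ) (z : E) :
    B.q ν z = (∫⁻ o, B.qTerm ν z o ^ (2 : ℝ) ∂Measure.count) ^ (1 / 2 : ℝ) := by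
  rw [lintegral_count, q, 
    tsum_eq_zero_add' (f := fun o => B.qTerm ν z o ^ (2 : ℝ)) ENNReal.summable, add_comm]
  congr 2
  · simp [qTerm]
  · refine tsum_congr fun n => ?_
    simp only [qTerm]
    rw [ENNReal.mul_rpow_of_nonneg _ _ (by norm_num), ← ENNReal.rpow_mul,
      div_mul_cancel₀ _ (by norm_num), ENNReal.rpow_natCast, ENNReal.rpow_two]

lemma q_add_le (ν : ℕ → ℕ) (y z : E) : B.q ν (y + z) ≤ B.q ν y + B.q ν z := by
  rw [q_eq, q_eq, q_eq]
  refine le_trans (ENNReal.rpow_le_rpow (lintegral_mono fun o => ENNReal.rpow_le_rpow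
    (z := 2) (?_ : B.qTerm ν (y + z) o ≤ (B.qTerm ν y + B.qTerm ν z) o) (by norm_num))
    (by norm_num)) (ENNReal.lintegral_Lp_add_le (measurable_of_countable _).aemeasurable
      (measurable_of_countable _).aemeasurable (by norm_num))
  rcases o with _ | n
  · simp only [qTerm, Pi.add_apply]
    rw [← ENNReal.tsum_add]
    refine ENNReal.tsum_le_tsum fun n => ?_
    rw [← mul_add, map_add]
    gcongr
    exact enorm_add_le _ _
  · simp only [qTerm, Pi.add_apply, map_add]
    rw [← mul_add, add_sub_add_comm]
    gcongr
    exact enorm_add_le _ _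

lemma q_smul (ν : ℕ → ℕ) (c : ℝ) (z : E) : B.q ν (c • z) = ‖c‖ₑ * B.q ν z := by
  simp only [q, map_smul, ← smul_sub, enorm_smul, mul_pow, mul_left_comm _ ‖c‖ₑ,
    mul_left_comm _ (‖c‖ₑ ^ 2), ENNReal.tsum_mul_left]
  rw [← mul_add, ENNReal.mul_rpow_of_nonneg _ _ (by norm_num), ← ENNReal.rpow_natCast,
    ← ENNReal.rpow_mul]
  norm_num

lemma q_zero (ν : ℕ → ℕ) : B.q ν 0 = 0 := by
  simpa using B.q_smul ν 0 0

lemma eq_zero_of_q_eq_zero (ν : ℕ → ℕ) {z : E} (h : B.q ν z = 0) : z = 0 := by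
  refine B.separates z 0 fun n => ?_
  rw [q, ENNReal.rpow_eq_zero_iff_of_pos (by norm_num), add_eq_zero,
    pow_eq_zero_iff (by norm_num), ENNReal.tsum_eq_zero,
    ENNReal.tsum_eq_zero] at h
  have h2 := (mul_eq_zero.1 (h.2 n)).resolve_left
    (by simp [ENNReal.rpow_eq_zero_iff])
  simpa using h2

/-- The linear subspace `E_x = [q_x < ∞]` of `E`. -/
def subspace (ν : ℕ → ℕ) : Submodule ℝ E where
  carrier := {z | B.q ν z < ∞}
  add_mem' {y z} hy hz := (B.q_add_le ν y z).trans_lt (ENNReal.add_lt_top.2 ⟨hy, hz⟩)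
  zero_mem' := by simp [q_zero]
  smul_mem' c z hz := by
    simp only [Set.mem_ofPred_eq, q_smul] at hz ⊢
    exact ENNReal.mul_lt_top enorm_lt_top hz

/-- The normed space `(E_x, q_x)`; this type synonym of `E_x` does not carry the norm of `E`. -/
def Space (ν : ℕ → ℕ) : Type _ := B.subspace ν

instance (ν : ℕ → ℕ) : AddCommGroup (B.Space ν) :=
  inferInstanceAs (AddCommGroup (B.subspace ν))

instance (ν : ℕ → ℕ) : Module ℝ (B.Space ν) :=
  inferInstanceAs (Module ℝ (B.subspace ν))

/-- The inclusion `E_x ⊂ E`. -/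
def incl (ν : ℕ → ℕ) : B.Space ν →ₗ[ℝ] E := (B.subspace ν).subtype

instance (ν : ℕ → ℕ) : Norm (B.Space ν) := ⟨fun z => (B.q ν (B.incl ν z)).toReal⟩

lemma q_incl_ne_top (ν : ℕ → ℕ) (z : B.Space ν) : B.q ν (B.incl ν z) ≠ ∞ :=
  ne_of_lt (show B.q ν (B.incl ν z) < ∞ from z.2)

lemma core (ν : ℕ → ℕ) : NormedSpace.Core ℝ (B.Space ν) where
  norm_nonneg _ := ENNReal.toReal_nonneg
  norm_smul c z := by
    change (B.q ν (B.incl ν (c • z))).toReal = ‖c‖ * (B.q ν (B.incl ν z)).toReal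
    rw [map_smul, q_smul, ENNReal.toReal_mul, toReal_enorm]
  norm_triangle y z := by
    change (B.q ν (B.incl ν (y + z))).toReal ≤
      (B.q ν (B.incl ν y)).toReal + (B.q ν (B.incl ν z)).toReal
    rw [map_add, ← ENNReal.toReal_add (B.q_incl_ne_top ν y) (B.q_incl_ne_top ν z)]
    exact ENNReal.toReal_mono
      (ENNReal.add_ne_top.2 ⟨B.q_incl_ne_top ν y, B.q_incl_ne_top ν z⟩) (B.q_add_le ν _ _)
  norm_eq_zero_iff z := by
    change (B.q ν (B.incl ν z)).toReal = 0 ↔ z = 0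
    constructor
    · intro h
      have h0 := ((ENNReal.toReal_eq_zero_iff _).1 h).resolve_right (B.q_incl_ne_top ν z)
      exact Subtype.ext (B.eq_zero_of_q_eq_zero ν h0)
    · rintro rfl
      simp [q_zero]

/-- The norm of `(E_x, q_x)` is `q_x`. -/
instance (ν : ℕ → ℕ) : NormedAddCommGroup (B.Space ν) := NormedAddCommGroup.ofCore (B.core ν)

instance (ν : ℕ → ℕ) : NormedSpace ℝ (B.Space ν) := NormedSpace.ofCore (B.core ν)

instance (ν : ℕ → ℕ) : MeasurableSpace (B.Space ν) := borel _

instance (ν : ℕ → ℕ) : BorelSpace (B.Space ν) := ⟨rfl⟩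

lemma norm_eq (ν : ℕ → ℕ) (z : B.Space ν) : ‖z‖ = (B.q ν (B.incl ν z)).toReal := rfl

end CarmonaBasis

end General

end AbstractWiener

end

/-!
For `x ∉ H`, evaluation at `x` is a functional on `E' ⊂ H` that is not continuous for the norm of
`H`, since a continuous one would be represented by an element of `H` equal to `x`. Such a
functional takes arbitrarily large values on unit vectors orthogonal to any finite-dimensional
subspace, so a Gram-Schmidt procedure applied to a separating sequence of `E'`, in which each new
direction is rotated against a vector with a huge value, gives an orthonormal basis with
`e_n(x) ≥ 2 ^ (n / 2)`.

The reflections `2 P̃_n - Id` preserve `μ`, and with tightness this gives `P̃_n z → z` in measure.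
Convergence in measure controls the variances of the functionals `l ∘ (Id - P̃_n)` uniformly over
the unit ball of `E'`, hence also the operator norm of `Id - P̃_n` from `H` to `E`.

Along the subsequence, the Cauchy-Schwarz inequality with the weights `2 ^ n` gives
`‖z - Q̃_m z‖ ≤ √(2 * 2⁻ᵐ) q_x(z)`, whence the norm comparison and the compactness of `E_x → E` as a
limit of finite-rank operators; lower semicontinuity of `q_x` gives completeness. Fernique's
theorem turns the bounds in measure on `Q̃_{n+1} z - Q̃_n z` into bounds on their second moments,
so `q_x` is square integrable. Finally, `Q̃_m z → z` in `E_x`, so functionals on `E_x` are limits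
of elements of `E'` and are Gaussian with the right variance.
-/

noncomputable section

namespace AbstractWiener

open Filter Topology

section DiscontinuousFunctional

/-! ### Large values of a discontinuous functional -/

variable {V : Type*} [NormedAddCommGroup V] [InnerProductSpace ℝ V] {φ : V →ₗ[ℝ] ℝ}

lemma exists_unit_mem_orthogonal_le_apply (hφ : ¬Continuous φ) (K : Submodule ℝ V)
    [FiniteDimensional ℝ K] (c : ℝ) : ∃ u ∈ Kᗮ, ‖u‖ = 1 ∧ c ≤ φ u := by
  by_contra! hc
  have apply_le (w : V) (hw : w ∈ Kᗮ) : φ w ≤ c * ‖w‖ := by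
    rcases eq_or_ne w 0 with rfl | hw0
    · simp
    have h := (hc (‖w‖⁻¹ • w) (Kᗮ.smul_mem _ hw) (norm_smul_inv_norm hw0)).le
    rwa [map_smul, smul_eq_mul, inv_mul_le_iff₀ (norm_pos_iff.2 hw0), mul_comm] at h
  have continuous_orthogonal : Continuous (φ.domRestrict Kᗮ) :=
    AddMonoidHomClass.continuous_of_bound _ c fun w => abs_le'.2
      ⟨apply_le w w.2, by simpa using apply_le (-w) (Kᗮ.neg_mem w.2)⟩
  have continuous_restrict : Continuous (φ.domRestrict K) :=
    LinearMap.continuous_of_finiteDimensional _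
  refine hφ (((continuous_restrict.comp K.orthogonalProjectionOnto.continuous).add
    (continuous_orthogonal.comp Kᗮ.orthogonalProjectionOnto.continuous)).congr fun w => ?_)
  exact (map_add φ _ _).symm.trans
    (congrArg φ (K.starProjection_add_starProjection_orthogonal w))

lemma orthonormal_rotation {u w : V} (h : Orthonormal ℝ ![u, w]) :
    Orthonormal ℝ ![(√2)⁻¹ • (u + w), (√2)⁻¹ • (u - w)] := by
  have huu : inner ℝ u u = (1 : ℝ) := inner_self_eq_one_of_norm_eq_one (h.1 0)
  have hww : inner ℝ w w = (1 : ℝ) := inner_self_eq_one_of_norm_eq_one (h.1 1)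
  have huw : inner ℝ u w = (0 : ℝ) := h.2 zero_ne_one
  have hwu : inner ℝ w u = (0 : ℝ) := h.2 one_ne_zero
  have hsqrt : (√2)⁻¹ * (√2)⁻¹ = (1 / 2 : ℝ) := by
    rw [← mul_inv, Real.mul_self_sqrt zero_le_two, one_div]
  rw [orthonormal_iff_ite]
  simp only [Fin.forall_fin_two, Matrix.cons_val_zero, Matrix.cons_val_one, inner_smul_left,
    inner_smul_right, inner_add_left, inner_add_right, inner_sub_left, inner_sub_right, huu, hww,
    huw, hwu, conj_trivial]
  norm_num [mul_add, hsqrt]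

-- `w` spans the component of `v` orthogonal to `K`; `φ w` may be small, but rotating `w` by `π / 4`
-- against a unit vector on which `φ` is huge makes `φ` large on both vectors of the pair.
lemma exists_orthonormal_pair_le_apply (hφ : ¬Continuous φ) (K : Submodule ℝ V)
    [FiniteDimensional ℝ K] (v : V) (c : ℝ) :
    ∃ b : Fin 2 → V, Orthonormal ℝ b ∧ (∀ k, b k ∈ Kᗮ) ∧ (∀ k, c ≤ φ (b k)) ∧
      v ∈ K ⊔ Submodule.span ℝ (Set.range b) := by
  obtain ⟨w, hwK, hw, hvw⟩ : ∃ w ∈ Kᗮ, ‖w‖ = 1 ∧ v - K.starProjection v ∈ ℝ ∙ w := by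
    rcases eq_or_ne (v - K.starProjection v) 0 with h0 | h0
    · obtain ⟨w, hwK, hw, -⟩ := exists_unit_mem_orthogonal_le_apply hφ K 0
      exact ⟨w, hwK, hw, h0 ▸ Submodule.zero_mem _⟩
    · refine ⟨_, Kᗮ.smul_mem _ (K.sub_starProjection_mem_orthogonal v), norm_smul_inv_norm h0,
        Submodule.mem_span_singleton.2 ⟨‖v - K.starProjection v‖, ?_⟩⟩
      exact smul_inv_smul₀ (norm_ne_zero_iff.2 h0) _
  obtain ⟨u, huKw, hu, hφu⟩ :=
    exists_unit_mem_orthogonal_le_apply hφ (K ⊔ ℝ ∙ w) (√2 * c + |φ w|)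
  rw [← Submodule.inf_orthogonal, Submodule.mem_inf,
    Submodule.mem_orthogonal_singleton_iff_inner_left] at huKw
  have huw : Orthonormal ℝ ![u, w] := by simp [hu, hw, huKw.2]
  have hw_mem : w ∈ Submodule.span ℝ
      (Set.range ![(√2)⁻¹ • (u + w), (√2)⁻¹ • (u - w)]) := by
    refine Matrix.range_cons_cons_empty _ _ _ ▸ Submodule.mem_span_pair.2 ⟨√2 / 2, -(√2 / 2), ?_⟩
    match_scalars <;> field_simp <;> norm_num
  refine ⟨_, orthonormal_rotation huw, ?_, ?_, ?_⟩
  · simp only [Fin.forall_fin_two, Matrix.cons_val_zero, Matrix.cons_val_one]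
    exact ⟨Kᗮ.smul_mem _ (Kᗮ.add_mem huKw.1 hwK), Kᗮ.smul_mem _ (Kᗮ.sub_mem huKw.1 hwK)⟩
  · simp only [Fin.forall_fin_two, Matrix.cons_val_zero, Matrix.cons_val_one, map_smul, map_add,
      map_sub, smul_eq_mul]
    rw [le_inv_mul_iff₀ (by positivity), le_inv_mul_iff₀ (by positivity)]
    constructor <;> linarith [neg_abs_le (φ w), le_abs_self (φ w)]
  · rw [← add_sub_cancel (K.starProjection v) v]
    exact Submodule.add_mem_sup (K.starProjection_apply_mem v)
      ((Submodule.span_singleton_le_iff_mem _ _).2 hw_mem hvw)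

lemma orthonormal_uncurry {ι : Type*} {K : ℕ → Submodule ℝ V} (hK : Monotone K)
    {b : ℕ → ι → V} (hb : ∀ n, Orthonormal ℝ (b n)) (hbK : ∀ n k, b n k ∈ K (n + 1))
    (hbK' : ∀ n k, b n k ∈ (K n)ᗮ) : Orthonormal ℝ fun p : ℕ × ι => b p.1 p.2 := by
  have inner_eq_zero {m n : ℕ} (h : m < n) (j k : ι) : inner ℝ (b m j) (b n k) = 0 :=
    (K n).inner_right_of_mem_orthogonal (hK h (hbK m j)) (hbK' n k)
  refine ⟨fun p => (hb p.1).1 p.2, ?_⟩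
  rintro ⟨m, j⟩ ⟨n, k⟩ hne
  rcases lt_trichotomy m n with h | rfl | h
  · exact inner_eq_zero h j k
  · exact (hb m).2 fun hjk => hne (Prod.ext rfl hjk)
  · exact inner_eq_zero_symm.1 (inner_eq_zero h k j)

lemma exists_orthonormal_le_apply_of_not_continuous (hφ : ¬Continuous φ) (v : ℕ → V)
    (c : ℕ → ℝ) :
    ∃ e : ℕ → V, Orthonormal ℝ e ∧ (∀ n, c n ≤ φ (e n)) ∧
      ∀ n, v n ∈ Submodule.span ℝ (Set.range e) := by
  choose b hb hbK hbc hbv using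
    fun (n : ℕ) (K : {K : Submodule ℝ V // FiniteDimensional ℝ K}) =>
      have := K.2
      exists_orthonormal_pair_le_apply hφ K.1 (v n) (max (c (2 * n)) (c (2 * n + 1)))
  let K : ℕ → {K : Submodule ℝ V // FiniteDimensional ℝ K} := Nat.rec ⟨⊥, inferInstance⟩
    fun n K => ⟨K.1 ⊔ Submodule.span ℝ (Set.range (b n K)),
      have := K.2
      have := FiniteDimensional.span_of_finite ℝ (Set.finite_range (b n K))
      inferInstance⟩
  have hK_mono : Monotone fun n => (K n).1 := monotone_nat_of_le_succ fun n => le_sup_left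
  have hbK_succ (n : ℕ) : Submodule.span ℝ (Set.range (b n (K n))) ≤ (K (n + 1)).1 := le_sup_right
  have he := (orthonormal_uncurry hK_mono (fun n => hb n (K n))
    (fun n k => hbK_succ n (Submodule.subset_span (Set.mem_range_self k)))
    fun n => hbK n (K n)).comp _ (Nat.divModEquiv 2).injective
  refine ⟨_, he, fun n => le_trans ?_ (hbc _ _ _), fun n => ?_⟩
  · rcases Nat.even_or_odd' n with ⟨m, rfl | rfl⟩
    · simp
    · have : (2 * m + 1) / 2 = m := by omega
      simp [this]
  · rw [(Nat.divModEquiv 2).surjective.range_comp]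
    suffices ∀ n, (K n).1 ≤ Submodule.span ℝ (Set.range fun p : ℕ × Fin 2 => b p.1 (K p.1) p.2) from
      this (n + 1) (hbv n (K n))
    intro n
    induction n with
    | zero => exact bot_le
    | succ n ih =>
      refine sup_le ih (Submodule.span_mono ?_)
      rintro _ ⟨k, rfl⟩
      exact ⟨(n, k), rfl⟩

end DiscontinuousFunctional

section Dual

/-! ### Evaluation at `x` on the range of `E' → H` -/

lemma exists_seq_dual_separating (E : Type*) [NormedAddCommGroup E] [NormedSpace ℝ E]
    [SecondCountableTopology E] :
    ∃ l : ℕ → StrongDual ℝ E, ∀ z, (∀ n, l n z = 0) → z = 0 := by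
  obtain ⟨T, hT, hT_union⟩ := TopologicalSpace.isOpen_iUnion_countable
    (fun l : StrongDual ℝ E => {z | l z ≠ 0}) fun l => isOpen_ne_fun l.continuous continuous_const
  obtain ⟨l, hl⟩ := Set.countable_iff_exists_subset_range.1 hT
  refine ⟨l, fun z hz => ?_⟩
  by_contra hz0
  obtain ⟨g, hg⟩ := SeparatingDual.exists_ne_zero (R := ℝ) hz0
  obtain ⟨g', hg'T, hg'⟩ := Set.mem_iUnion₂.1 (hT_union.ge (Set.mem_iUnion.2 ⟨g, hg⟩))
  obtain ⟨n, rfl⟩ := hl hg'T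
  exact hg' (hz n)

variable {H E : Type*} [NormedAddCommGroup H] [InnerProductSpace ℝ H] [CompleteSpace H]
  [NormedAddCommGroup E] [NormedSpace ℝ E] (i : H →L[ℝ] E)

lemma inner_dualToH (l : StrongDual ℝ E) (h : H) : inner ℝ (dualToH i l) h = l (i h) := by
  simp [dualToH]

/-- The canonical map `E' → H' ≡ H` as a linear map. -/
def dualToHₗ : StrongDual ℝ E →ₗ[ℝ] H where
  toFun := dualToH i
  map_add' l m := by simp [dualToH]
  map_smul' c l := by simp [dualToH]

lemma dualToHₗ_apply (l : StrongDual ℝ E) : dualToHₗ i l = dualToH i l := rfl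

variable {i}

lemma dualToHₗ_injective (hi : DenseRange i) : Function.Injective (dualToHₗ i) := by
  refine (injective_iff_map_eq_zero _).2 fun l hl => ?_
  have apply_incl (h : H) : l (i h) = 0 := by
    rw [← inner_dualToH, ← dualToHₗ_apply, hl, inner_zero_left]
  exact ContinuousLinearMap.ext fun z =>
    congrFun (hi.equalizer l.continuous continuous_zero (funext apply_incl)) z

/-- Evaluation at `x ∈ E` as a linear functional on the image of `E'` in `H`; it is in general not
continuous for the norm of `H`. -/
def dualRangeEval (hi : DenseRange i) (x : E) : (dualToHₗ i).range →ₗ[ℝ] ℝ :=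
  (ContinuousLinearMap.apply ℝ ℝ x).toLinearMap ∘ₗ
    (LinearEquiv.ofInjective (dualToHₗ i) (dualToHₗ_injective hi)).symm.toLinearMap

lemma dualRangeEval_rangeRestrict (hi : DenseRange i) (x : E) (l : StrongDual ℝ E) :
    dualRangeEval hi x ((dualToHₗ i).rangeRestrict l) = l x :=
  congrArg (fun l : StrongDual ℝ E => l x)
    ((LinearEquiv.ofInjective (dualToHₗ i) (dualToHₗ_injective hi)).symm_apply_apply l)

lemma not_continuous_dualRangeEval (hi : DenseRange i) {x : E} (hx : x ∉ Set.range i) :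
    ¬Continuous (dualRangeEval hi x) := by
  intro hcont
  obtain ⟨g, hg, -⟩ := exists_extension_norm_eq (𝕜 := ℝ) _ ⟨dualRangeEval hi x, hcont⟩
  refine hx ⟨(InnerProductSpace.toDual ℝ H).symm g, ?_⟩
  refine (SeparatingDual.eq_iff_forall_dual_eq (R := ℝ)).2 fun l => ?_
  calc l (i ((InnerProductSpace.toDual ℝ H).symm g))
      = g (dualToH i l) := by
        rw [← inner_dualToH, real_inner_comm, InnerProductSpace.toDual_symm_apply]
    _ = l x := (hg ((dualToHₗ i).rangeRestrict l)).trans (dualRangeEval_rangeRestrict hi x l)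

lemma exists_carmonaBasis [TopologicalSpace.SeparableSpace H] (hinj : Function.Injective i)
    (hi : DenseRange i) {x : E} (hx : x ∉ Set.range i) : Nonempty (CarmonaBasis i x) := by
  have : TopologicalSpace.SeparableSpace E := hi.separableSpace i.continuous
  have : SecondCountableTopology E := UniformSpace.secondCountable_of_separable E
  obtain ⟨l, hl⟩ := exists_seq_dual_separating E
  obtain ⟨f, hf, hfx, hlf⟩ := exists_orthonormal_le_apply_of_not_continuous
    (not_continuous_dualRangeEval hi hx) (fun n => (dualToHₗ i).rangeRestrict (l n))
    (fun n => (2 : ℝ) ^ (((n : ℝ) + 1) / 2))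
  choose e he using fun n => (dualToHₗ i).surjective_rangeRestrict (f n)
  obtain rfl : (fun n => (dualToHₗ i).rangeRestrict (e n)) = f := funext he
  have eq_zero (z : E) (hz : ∀ n, e n z = 0) : z = 0 := by
    refine hl z fun n => ?_
    rw [← dualRangeEval_rangeRestrict hi z (l n)]
    refine (Submodule.span_le (p := (dualRangeEval hi z).ker)).2 ?_ (hlf n)
    rintro _ ⟨k, rfl⟩
    exact (dualRangeEval_rangeRestrict hi z (e k)).trans (hz k)
  exact ⟨{
    e := e
    orthonormal := hf.comp_linearIsometry (dualToHₗ i).range.subtypeₗᵢ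
    total := by
      rw [Submodule.topologicalClosure_eq_top_iff, Submodule.eq_bot_iff]
      refine fun h hh => hinj ((eq_zero _ fun n => ?_).trans (map_zero i).symm)
      rw [← inner_dualToH]
      exact Submodule.inner_right_of_mem_orthogonal
        (Submodule.subset_span (Set.mem_range_self n)) hh
    separates := fun y z hyz =>
      sub_eq_zero.1 (eq_zero _ fun n => by rw [map_sub, hyz n, sub_self])
    growth := fun n => by simpa only [dualRangeEval_rangeRestrict] using hfx n }⟩

end Dual

namespace CarmonaBasis

/-! ### The projections `P̃_n` -/

variable {H E : Type*} [NormedAddCommGroup H] [InnerProductSpace ℝ H] [CompleteSpace H]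
  [NormedAddCommGroup E] [NormedSpace ℝ E] {i : H →L[ℝ] E} {x : E} (B : CarmonaBasis i x)

lemma proj_apply (n : ℕ) (z : E) :
    B.proj n z = ∑ k ∈ Finset.range n, B.e k z • dualToH i (B.e k) := by
  simp [proj]

lemma e_proj (k n : ℕ) (z : E) :
    B.e k (i (B.proj n z)) = if k < n then B.e k z else 0 := by
  rw [← inner_dualToH, proj_apply, inner_sum]
  simp only [inner_smul_right, orthonormal_iff_ite.1 B.orthonormal, mul_ite, mul_one, mul_zero,
    Finset.sum_ite_eq, Finset.mem_range]

lemma proj_proj (m n : ℕ) (z : E) : B.proj m (i (B.proj n z)) = B.proj (min m n) z := by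
  simp only [proj_apply _ m, proj_apply _ (min m n), e_proj, ite_smul, zero_smul]
  rw [← Finset.sum_filter]
  congr 1
  ext k
  simp

lemma norm_proj_sub_proj_le {m n : ℕ} (hmn : n ≤ m) (h : H) :
    ‖B.proj m (i h) - B.proj n (i h)‖ ≤ ‖h‖ := by
  refine (sq_le_sq₀ (norm_nonneg _) (norm_nonneg _)).1 ?_
  calc ‖B.proj m (i h) - B.proj n (i h)‖ ^ 2
      = ‖∑ k ∈ Finset.Ico n m, B.e k (i h) • dualToH i (B.e k)‖ ^ 2 := by
        rw [proj_apply, proj_apply, Finset.sum_Ico_eq_sub _ hmn]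
    _ = ∑ k ∈ Finset.Ico n m, ‖inner ℝ (dualToH i (B.e k)) h‖ ^ 2 := by
        rw [← real_inner_self_eq_norm_sq, B.orthonormal.inner_sum]
        simp only [inner_dualToH, conj_trivial, Real.norm_eq_abs, sq, abs_mul_abs_self]
    _ ≤ ‖h‖ ^ 2 := B.orthonormal.sum_inner_products_le h

lemma tendsto_proj (h : H) : Tendsto (fun n => B.proj n (i h)) atTop (𝓝 h) := by
  let b := HilbertBasis.mk B.orthonormal B.total.ge
  refine (b.hasSum_repr h).tendsto_sum_nat.congr fun n => ?_
  rw [proj_apply]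
  refine Finset.sum_congr rfl fun k _ => ?_
  rw [b.repr_apply_apply, HilbertBasis.coe_mk, inner_dualToH]

lemma inner_proj_left (n : ℕ) (g h : H) :
    inner ℝ (B.proj n (i g)) h = inner ℝ g (B.proj n (i h)) := by
  rw [proj_apply, proj_apply, sum_inner, inner_sum]
  refine Finset.sum_congr rfl fun k _ => ?_
  rw [real_inner_smul_left, inner_smul_right, inner_dualToH, real_inner_comm, inner_dualToH,
    mul_comm]

lemma dualToH_comp_proj (l : StrongDual ℝ E) (n : ℕ) :
    dualToH i (l ∘L i ∘L B.proj n) = B.proj n (i (dualToH i l)) := by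
  refine ext_inner_right ℝ fun h => ?_
  rw [inner_dualToH, inner_proj_left, inner_dualToH]
  rfl

/-- The reflection `z ↦ 2 P̃_n z - z` of `E`, which preserves `μ`. -/
def reflection (n : ℕ) : E →L[ℝ] E := (2 : ℝ) • i ∘L B.proj n - ContinuousLinearMap.id ℝ E

lemma reflection_apply (n : ℕ) (z : E) : B.reflection n z = (2 : ℝ) • i (B.proj n z) - z := rfl

lemma norm_dualToH_comp_reflection (l : StrongDual ℝ E) (n : ℕ) :
    ‖dualToH i (l ∘L B.reflection n)‖ = ‖dualToH i l‖ := by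
  have dualToH_eq : dualToH i (l ∘L B.reflection n) =
      (2 : ℝ) • B.proj n (i (dualToH i l)) - dualToH i l := by
    rw [← dualToH_comp_proj]
    simp only [← dualToHₗ_apply, ← map_smul, ← map_sub]
    congr 1
    ext z
    simp [reflection_apply]
  have norm_proj_sq : ‖B.proj n (i (dualToH i l))‖ ^ 2 =
      inner ℝ (B.proj n (i (dualToH i l))) (dualToH i l) := by
    rw [← real_inner_self_eq_norm_sq, ← inner_proj_left, proj_proj, min_self]
  rw [dualToH_eq, ← sq_eq_sq₀ (norm_nonneg _) (norm_nonneg _), norm_sub_sq_real, norm_smul,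
    real_inner_smul_left, ← norm_proj_sq, mul_pow, Real.norm_ofNat]
  ring

end CarmonaBasis

section Gaussian

/-! ### Convergence of the projections in measure and in operator norm -/

lemma gaussianReal_one_lt_abs_pos : 0 < gaussianReal 0 1 {y : ℝ | 1 < |y|} := by
  have hopen : IsOpen {y : ℝ | 1 < |y|} := isOpen_lt continuous_const continuous_abs
  exact pos_iff_ne_zero.2 fun h => (hopen.measure_pos volume ⟨2, by norm_num⟩).ne'
    (gaussianReal_absolutelyContinuous' 0 one_ne_zero h)

variable {H E : Type*} [NormedAddCommGroup H] [InnerProductSpace ℝ H] [CompleteSpace H]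
  [NormedAddCommGroup E] [NormedSpace ℝ E] {i : H →L[ℝ] E} {x : E}

lemma CarmonaBasis.exists_forall_mem_exists_lt_ne_zero (B : CarmonaBasis i x) {D : Set E}
    (hD : IsCompact D) (h0 : 0 ∉ D) : ∃ N, ∀ y ∈ D, ∃ k < N, B.e k y ≠ 0 := by
  obtain ⟨t, ht⟩ := hD.elim_finite_subcover (fun k => {y | B.e k y ≠ 0})
    (fun k => isOpen_ne_fun (B.e k).continuous continuous_const) fun y hy => by
      by_contra hn
      simp only [Set.mem_iUnion, Set.mem_ofPred_eq, not_exists, not_not] at hn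
      exact h0 (B.separates y 0 (fun n => by rw [hn n, map_zero]) ▸ hy)
  refine ⟨t.sup id + 1, fun y hy => ?_⟩
  obtain ⟨k, hkt, hk⟩ := Set.mem_iUnion₂.1 (ht hy)
  exact ⟨k, Nat.lt_succ_of_le (Finset.le_sup (f := id) hkt), hk⟩

variable [MeasurableSpace E] [BorelSpace E] {μ : Measure E}

namespace IsAbstractWienerSpace

lemma isGaussian (hW : IsAbstractWienerSpace i μ) : IsGaussian μ :=
  isGaussian_of_map_eq_gaussianReal fun l => ⟨_, _, hW.gaussian l⟩

lemma integral_dual_eq_zero (hW : IsAbstractWienerSpace i μ) (l : StrongDual ℝ E) :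
    ∫ z, l z ∂μ = 0 := by
  have integral_map_eq_zero : ∫ y, y ∂(μ.map l) = 0 := by
    rw [hW.gaussian l, integral_id_gaussianReal]
  rwa [integral_map (by fun_prop) (by fun_prop)] at integral_map_eq_zero

lemma charFunDual_eq (hW : IsAbstractWienerSpace i μ) (l : StrongDual ℝ E) :
    charFunDual μ l = Complex.exp (-(‖dualToH i l‖ : ℂ) ^ 2 / 2) := by
  rw [charFunDual_eq_charFun_map_one, hW.gaussian l, charFun_gaussianReal]
  congr 1
  simp [neg_div]

lemma secondCountable (hW : IsAbstractWienerSpace i μ) : SecondCountableTopology E := by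
  have := hW.separable
  have : TopologicalSpace.SeparableSpace E := hW.dense.separableSpace i.continuous
  exact UniformSpace.secondCountable_of_separable E

lemma map_eq_self (hW : IsAbstractWienerSpace i μ) (S : E →L[ℝ] E)
    (hS : ∀ l : StrongDual ℝ E, ‖dualToH i (l ∘L S)‖ = ‖dualToH i l‖) : μ.map S = μ := by
  have := hW.isGaussian
  have := hW.secondCountable
  have := hW.complete
  have : IsProbabilityMeasure (μ.map S) := Measure.isProbabilityMeasure_map (by fun_prop)
  refine Measure.ext_of_charFunDual (funext fun l => ?_)
  rw [charFunDual_map, hW.charFunDual_eq, hW.charFunDual_eq, hS]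

-- Convergence in measure without the martingale convergence theorem: if `z` and its reflection
-- `2 P̃_n z - z` both lie in a compact `K` of almost full measure, then the remainder `z - P̃_n z`
-- lies in the compact set `(K - K) / 2`, where finitely many `e_k` detect vectors of norm `≥ ε`;
-- but `e_0, …, e_{n-1}` vanish on the remainder.
lemma tendsto_measure_lt_norm_sub_proj (hW : IsAbstractWienerSpace i μ) (B : CarmonaBasis i x)
    {ε : ℝ} (hε : 0 < ε) :
    Tendsto (fun n => μ {z | ε < ‖z - i (B.proj n z)‖}) atTop (𝓝 0) := by
  have := hW.isGaussian
  have := hW.secondCountable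
  have := hW.complete
  rw [ENNReal.tendsto_atTop_zero]
  intro δ hδ
  obtain ⟨K, hK, hKμ⟩ := isTightMeasureSet_iff_exists_isCompact_measure_compl_le.1
    (isTightMeasureSet_singleton (μ := μ)) (δ / 2) (ENNReal.half_pos hδ.ne')
  let D : Set E := (fun p : E × E => (1 / 2 : ℝ) • (p.1 - p.2)) '' (K ×ˢ K) ∩ {y | ε ≤ ‖y‖}
  have hD : IsCompact D := ((hK.prod hK).image (by fun_prop)).inter_right
    (isClosed_le continuous_const continuous_norm)
  obtain ⟨N, hN⟩ := B.exists_forall_mem_exists_lt_ne_zero hD fun h0 => by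
    simpa using hε.trans_le h0.2
  refine ⟨N, fun n hn => ?_⟩
  have subset_union : {z | ε < ‖z - i (B.proj n z)‖} ⊆ Kᶜ ∪ B.reflection n ⁻¹' Kᶜ := by
    intro z (hz : ε < ‖z - i (B.proj n z)‖)
    by_contra hzK
    simp only [Set.mem_union, Set.mem_compl_iff, Set.mem_preimage, not_or, not_not] at hzK
    obtain ⟨k, hkN, hk⟩ := hN (z - i (B.proj n z))
      ⟨⟨(z, B.reflection n z), hzK, by simp only [B.reflection_apply]; module⟩, hz.le⟩
    exact hk (by rw [map_sub, B.e_proj, if_pos (hkN.trans_le hn), sub_self])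
  calc μ {z | ε < ‖z - i (B.proj n z)‖}
      ≤ μ Kᶜ + μ (B.reflection n ⁻¹' Kᶜ) :=
        (measure_mono subset_union).trans (measure_union_le _ _)
    _ = μ Kᶜ + μ Kᶜ := by
        rw [← Measure.map_apply (by fun_prop) hK.measurableSet.compl,
          hW.map_eq_self _ fun l => B.norm_dualToH_comp_reflection l n]
    _ ≤ δ / 2 + δ / 2 := add_le_add (hKμ μ rfl) (hKμ μ rfl)
    _ = δ := ENNReal.add_halves δ

lemma norm_dualToH_le (hW : IsAbstractWienerSpace i μ) (l : StrongDual ℝ E) {ε : ℝ} (hε : 0 ≤ ε)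
    (h : μ {z | ε < |l z|} < gaussianReal 0 1 {y : ℝ | 1 < |y|}) : ‖dualToH i l‖ ≤ ε := by
  by_contra! hlt
  have measurableSet_lt_abs : MeasurableSet {y : ℝ | ε < |y|} :=
    measurableSet_lt measurable_const measurable_norm
  have map_l : μ.map l = (gaussianReal 0 1).map (‖dualToH i l‖ * ·) := by
    rw [hW.gaussian l, gaussianReal_map_const_mul, mul_zero, mul_one]
    rfl
  refine h.not_ge ?_
  calc gaussianReal 0 1 {y : ℝ | 1 < |y|}
      ≤ gaussianReal 0 1 ((‖dualToH i l‖ * ·) ⁻¹' {y : ℝ | ε < |y|}) := by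
        refine measure_mono fun y (hy : 1 < |y|) => ?_
        rw [Set.mem_preimage, Set.mem_ofPred_eq, abs_mul, abs_norm]
        nlinarith
    _ = μ {z | ε < |l z|} := by
        rw [← Measure.map_apply (by fun_prop) measurableSet_lt_abs, ← map_l,
          Measure.map_apply (by fun_prop) measurableSet_lt_abs]
        rfl

lemma eventually_opNorm_le (hW : IsAbstractWienerSpace i μ) (B : CarmonaBasis i x)
    {ε : ℝ} (hε : 0 < ε) :
    ∀ᶠ n in atTop, ‖i - (i ∘L B.proj n) ∘L i‖ ≤ ε := by
  filter_upwards [(hW.tendsto_measure_lt_norm_sub_proj B hε).eventually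
    (gt_mem_nhds gaussianReal_one_lt_abs_pos)] with n hn
  refine ContinuousLinearMap.opNorm_le_bound _ hε.le fun h => ?_
  obtain ⟨l, hl_norm, hl⟩ := exists_dual_vector'' ℝ ((i - (i ∘L B.proj n) ∘L i) h)
  let m : StrongDual ℝ E := l ∘L (ContinuousLinearMap.id ℝ E - i ∘L B.proj n)
  have abs_m_le (z : E) : |m z| ≤ ‖z - i (B.proj n z)‖ := by
    simpa [m] using l.le_of_opNorm_le hl_norm (z - i (B.proj n z))
  calc ‖(i - (i ∘L B.proj n) ∘L i) h‖
      = inner ℝ (dualToH i m) h := by rw [inner_dualToH]; exact hl.symm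
    _ ≤ ‖dualToH i m‖ * ‖h‖ := real_inner_le_norm _ _
    _ ≤ ε * ‖h‖ := by
        gcongr
        exact hW.norm_dualToH_le m hε.le
          ((measure_mono fun z hz => lt_of_lt_of_le hz (abs_m_le z)).trans_lt hn)

lemma exists_isAdmissible (hW : IsAbstractWienerSpace i μ) (B : CarmonaBasis i x) :
    ∃ ν : ℕ → ℕ, B.IsAdmissible μ ν := by
  obtain ⟨φ, hφ_mono, hφ⟩ := extraction_forall_of_eventually (P := fun n k =>
    1 ≤ k ∧ ‖i - (i ∘L B.proj k) ∘L i‖ ≤ (1 / 2 : ℝ) ^ (n + 1) ∧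
      μ {z | (1 / 2 : ℝ) ^ (n + 1) < ‖z - i (B.proj k z)‖} ≤ (1 / 2 : ℝ≥0∞) ^ (n + 1)) fun n => by
    have half_pow_pos : (0 : ℝ) < (1 / 2 : ℝ) ^ (n + 1) := by positivity
    exact (eventually_ge_atTop 1).and ((hW.eventually_opNorm_le B half_pow_pos).and
      ((hW.tendsto_measure_lt_norm_sub_proj B half_pow_pos).eventually
        (ge_mem_nhds (ENNReal.pow_pos (by simp) _))))
  refine ⟨fun n => Nat.casesOn n 0 φ, strictMono_nat_of_lt_succ fun n => ?_, rfl, fun n hn => ?_,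
    fun n hn => ?_⟩
  · cases n with
    | zero => exact (hφ 0).1
    | succ n => exact hφ_mono n.lt_succ_self
  all_goals obtain ⟨n, rfl⟩ := Nat.exists_eq_succ_of_ne_zero (Nat.one_le_iff_ne_zero.1 hn)
  · exact (hφ n).2.1
  · exact (hφ n).2.2

end IsAbstractWienerSpace

end Gaussian

section Series

/-! ### Series in `[0, ∞]` -/

lemma tsum_mul_sq_le (f g : ℕ → ℝ≥0∞) :
    (∑' n, f n * g n) ^ 2 ≤ (∑' n, f n ^ 2) * ∑' n, g n ^ 2 := by
  have holder := ENNReal.lintegral_mul_le_Lp_mul_Lq Measure.count Real.HolderConjugate.two_two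
    (measurable_of_countable f).aemeasurable (measurable_of_countable g).aemeasurable
  simp only [lintegral_count, Pi.mul_apply, ENNReal.rpow_two] at holder
  refine (pow_le_pow_left₀ zero_le holder 2).trans_eq ?_
  rw [mul_pow, ← ENNReal.rpow_natCast, ← ENNReal.rpow_natCast, ← ENNReal.rpow_mul,
    ← ENNReal.rpow_mul]
  norm_num

lemma tsum_weight_mul_sq_le (w f : ℕ → ℝ≥0∞) :
    (∑' n, w n * f n) ^ 2 ≤ (∑' n, w n) * ∑' n, w n * f n ^ 2 := by
  have sqrt_sq (a : ℝ≥0∞) : (a ^ (1 / 2 : ℝ)) ^ 2 = a := by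
    rw [← ENNReal.rpow_natCast, ← ENNReal.rpow_mul]
    norm_num
  calc (∑' n, w n * f n) ^ 2
      = (∑' n, w n ^ (1 / 2 : ℝ) * (w n ^ (1 / 2 : ℝ) * f n)) ^ 2 := by
        simp only [← mul_assoc, ← sq, sqrt_sq]
    _ ≤ _ := tsum_mul_sq_le _ _
    _ = (∑' n, w n) * ∑' n, w n * f n ^ 2 := by simp only [mul_pow, sqrt_sq]

lemma inv_two_pow_mul_two_pow (n : ℕ) : (2⁻¹ : ℝ≥0∞) ^ n * 2 ^ n = 1 := by
  rw [← mul_pow, ENNReal.inv_mul_cancel two_ne_zero ENNReal.ofNat_ne_top, one_pow]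

lemma tsum_inv_two_pow_succ : ∑' n : ℕ, (2⁻¹ : ℝ≥0∞) ^ (n + 1) = 1 := by
  rw [ENNReal.tsum_geometric_add_one, ENNReal.one_sub_inv_two, inv_inv,
    ENNReal.inv_mul_cancel two_ne_zero ENNReal.ofNat_ne_top]

lemma two_rpow_neg_half_sq (n : ℕ) :
    ((2 : ℝ≥0∞) ^ (-(((n : ℝ) + 1) / 2))) ^ 2 = 2⁻¹ ^ (n + 1) := by
  rw [← neg_div, ← ENNReal.rpow_natCast, ← ENNReal.rpow_mul, Nat.cast_ofNat,
    div_mul_cancel₀ _ two_ne_zero, ENNReal.rpow_neg, ← ENNReal.inv_pow, ← ENNReal.rpow_natCast]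
  push_cast
  rfl

lemma tendsto_tsum_tail {a : ℕ → ℝ≥0∞} (ha : ∑' n, a n ≠ ∞) :
    Tendsto (fun m => ∑' n, if n < m then 0 else a n) atTop (𝓝 0) := by
  refine (ENNReal.tendsto_sum_nat_add a ha).congr fun m => ?_
  rw [← ENNReal.summable.sum_add_tsum_nat_add' (k := m) (f := fun n => if n < m then 0 else a n),
    Finset.sum_eq_zero fun n hn => if_pos (Finset.mem_range.1 hn), zero_add]
  simp

end Series

namespace CarmonaBasis

/-! ### The norm `q_x` -/

variable {H E : Type*} [NormedAddCommGroup H] [InnerProductSpace ℝ H] [CompleteSpace H]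
  [NormedAddCommGroup E] [NormedSpace ℝ E] {i : H →L[ℝ] E} {x : E} (B : CarmonaBasis i x)
  {ν : ℕ → ℕ}

/-- The increment `Q̃_{n+1} - Q̃_n`, as an operator on `E`. -/
def incr (ν : ℕ → ℕ) (n : ℕ) : E →L[ℝ] E := i ∘L B.proj (ν (n + 1)) - i ∘L B.proj (ν n)

lemma incr_apply (ν : ℕ → ℕ) (n : ℕ) (z : E) :
    B.incr ν n z = i (B.proj (ν (n + 1)) z) - i (B.proj (ν n) z) := rfl

lemma q_sq (ν : ℕ → ℕ) (z : E) :
    B.q ν z ^ 2 = (∑' n : ℕ, (2 : ℝ≥0∞) ^ n * ‖B.incr ν n z‖ₑ ^ 2) +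
      (∑' n : ℕ, (2 : ℝ≥0∞) ^ (-(((n : ℝ) + 1) / 2)) * ‖B.e n z‖ₑ) ^ 2 := by
  rw [q, ← ENNReal.rpow_natCast, ← ENNReal.rpow_mul]
  norm_num [incr_apply]

lemma lowerSemicontinuous_q (ν : ℕ → ℕ) : LowerSemicontinuous fun z => B.q ν z := by
  have lowerSemicontinuous_tsum_incr : LowerSemicontinuous fun z : E =>
      ∑' n : ℕ, (2 : ℝ≥0∞) ^ n * ‖i (B.proj (ν (n + 1)) z) - i (B.proj (ν n) z)‖ₑ ^ 2 :=
    lowerSemicontinuous_tsum fun n => ((ENNReal.continuous_const_mul (by simp)).comp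
      ((ENNReal.continuous_pow 2).comp (by fun_prop))).lowerSemicontinuous
  have lowerSemicontinuous_tsum_e : LowerSemicontinuous fun z : E =>
      ∑' n : ℕ, (2 : ℝ≥0∞) ^ (-(((n : ℝ) + 1) / 2)) * ‖B.e n z‖ₑ :=
    lowerSemicontinuous_tsum fun n => ((ENNReal.continuous_const_mul
      (by simp [ENNReal.rpow_eq_top_iff])).comp (by fun_prop)).lowerSemicontinuous
  exact ENNReal.continuous_rpow_const.comp_lowerSemicontinuous
    (lowerSemicontinuous_tsum_incr.add ((ENNReal.continuous_pow 2).comp_lowerSemicontinuous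
      lowerSemicontinuous_tsum_e fun a b hab => pow_le_pow_left₀ zero_le hab 2))
    (ENNReal.monotone_rpow_of_nonneg (by norm_num))

lemma tsum_enorm_incr_sq_le (ν : ℕ → ℕ) (z : E) (m : ℕ) :
    (∑' n, ‖B.incr ν (n + m) z‖ₑ) ^ 2 ≤ 2 * 2⁻¹ ^ m * B.q ν z ^ 2 := by
  have cancel (k : ℕ) (a : ℝ≥0∞) : 2⁻¹ ^ k * (2 ^ k * a) = a := by
    rw [← mul_assoc, inv_two_pow_mul_two_pow, one_mul]
  calc (∑' n, ‖B.incr ν (n + m) z‖ₑ) ^ 2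
      = (∑' n, 2⁻¹ ^ (n + m) * (2 ^ (n + m) * ‖B.incr ν (n + m) z‖ₑ)) ^ 2 := by simp only [cancel]
    _ ≤ (∑' n, 2⁻¹ ^ (n + m)) *
          ∑' n, 2⁻¹ ^ (n + m) * (2 ^ (n + m) * ‖B.incr ν (n + m) z‖ₑ) ^ 2 :=
        tsum_weight_mul_sq_le _ _
    _ = 2 * 2⁻¹ ^ m * ∑' n, 2 ^ (n + m) * ‖B.incr ν (n + m) z‖ₑ ^ 2 := by
        simp only [mul_pow, sq ((2 : ℝ≥0∞) ^ _), mul_assoc, cancel]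
        simp only [pow_add (2⁻¹ : ℝ≥0∞), ENNReal.tsum_mul_right, ENNReal.tsum_geometric_two,
          mul_assoc]
    _ ≤ 2 * 2⁻¹ ^ m * B.q ν z ^ 2 := by
        rw [q_sq]
        gcongr
        exact le_add_right (ENNReal.tsum_comp_le_tsum_of_injective (add_left_injective m)
          fun n => (2 : ℝ≥0∞) ^ n * ‖B.incr ν n z‖ₑ ^ 2)

lemma sum_incr (h0 : ν 0 = 0) (z : E) (n : ℕ) :
    ∑ k ∈ Finset.range n, B.incr ν k z = i (B.proj (ν n) z) := by
  simp only [incr_apply]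
  rw [Finset.sum_range_sub (fun k => i (B.proj (ν k) z)), h0]
  simp [proj_apply]

lemma hasSum_incr [CompleteSpace E] (hν : StrictMono ν) (h0 : ν 0 = 0) {z : E}
    (hz : B.q ν z ≠ ∞) : HasSum (fun n => B.incr ν n z) z := by
  have tsum_ne_top : ∑' n, ‖B.incr ν n z‖ₑ ≠ ∞ := by
    have sq_ne_top := ne_top_of_le_ne_top
      (ENNReal.mul_ne_top (by simp) (ENNReal.pow_ne_top hz)) (B.tsum_enorm_incr_sq_le ν z 0)
    simpa using sq_ne_top
  have hasSum_tsum : HasSum (fun n => B.incr ν n z) (∑' n, B.incr ν n z) :=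
    (Summable.of_enorm tsum_ne_top).hasSum
  suffices tsum_eq : ∑' n, B.incr ν n z = z by rwa [tsum_eq] at hasSum_tsum
  have tendsto_proj_tsum : Tendsto (fun n => i (B.proj (ν n) z)) atTop
      (𝓝 (∑' n, B.incr ν n z)) := by
    simpa only [B.sum_incr h0] using hasSum_tsum.tendsto_sum_nat
  refine B.separates _ _ fun k => tendsto_nhds_unique
    (((B.e k).continuous.tendsto _).comp tendsto_proj_tsum) (tendsto_const_nhds.congr' ?_)
  filter_upwards [eventually_gt_atTop k] with n hn
  rw [Function.comp_apply, e_proj, if_pos (hn.trans_le (hν.id_le n))]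

lemma enorm_sub_proj_le [CompleteSpace E] (hν : StrictMono ν) (h0 : ν 0 = 0) (z : E) (m : ℕ) :
    ‖z - i (B.proj (ν m) z)‖ₑ ≤ ENNReal.ofReal √(2 * (1 / 2) ^ m) * B.q ν z := by
  rcases eq_or_ne (B.q ν z) ∞ with hz | hz
  · rw [hz, ENNReal.mul_top (by simp)]
    exact le_top
  have hasSum_tail := (hasSum_nat_add_iff' m).2 (B.hasSum_incr hν h0 hz)
  rw [B.sum_incr h0] at hasSum_tail
  refine (ENNReal.pow_le_pow_left_iff two_ne_zero).1 ?_
  calc ‖z - i (B.proj (ν m) z)‖ₑ ^ 2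
      ≤ (∑' n, ‖B.incr ν (n + m) z‖ₑ) ^ 2 := by
        rw [← hasSum_tail.tsum_eq]
        gcongr
        exact enorm_tsum_le_tsum_enorm
    _ ≤ 2 * 2⁻¹ ^ m * B.q ν z ^ 2 := B.tsum_enorm_incr_sq_le ν z m
    _ = (ENNReal.ofReal √(2 * (1 / 2) ^ m) * B.q ν z) ^ 2 := by
        rw [mul_pow, ← ENNReal.ofReal_pow (by positivity), Real.sq_sqrt (by positivity),
          ENNReal.ofReal_mul zero_le_two, ENNReal.ofReal_pow (by positivity), one_div,
          ENNReal.ofReal_inv_of_pos two_pos, ENNReal.ofReal_ofNat]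

lemma enorm_le_q [CompleteSpace E] (hν : StrictMono ν) (h0 : ν 0 = 0) (z : E) :
    ‖z‖ₑ ≤ ENNReal.ofReal √2 * B.q ν z := by
  simpa [h0, proj_apply] using B.enorm_sub_proj_le hν h0 z 0

lemma norm_incl_sub_proj_le [CompleteSpace E] (hν : StrictMono ν) (h0 : ν 0 = 0)
    (z : B.Space ν) (m : ℕ) :
    ‖B.incl ν z - i (B.proj (ν m) (B.incl ν z))‖ ≤ √(2 * (1 / 2) ^ m) * ‖z‖ := by
  have h := ENNReal.toReal_mono (ENNReal.mul_ne_top ENNReal.ofReal_ne_top (B.q_incl_ne_top ν z))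
    (B.enorm_sub_proj_le hν h0 (B.incl ν z) m)
  rwa [ENNReal.toReal_mul, ENNReal.toReal_ofReal (by positivity), toReal_enorm, ← norm_eq] at h

/-- The inclusion of `E_x` with its norm `q_x` into `E`, as a continuous linear map. -/
def inclL [CompleteSpace E] (hν : StrictMono ν) (h0 : ν 0 = 0) : B.Space ν →L[ℝ] E :=
  (B.incl ν).mkContinuous √2 fun z => by
    simpa [h0, proj_apply] using B.norm_incl_sub_proj_le hν h0 z 0

lemma incl_injective (ν : ℕ → ℕ) : Function.Injective (B.incl ν) :=
  (B.subspace ν).subtype_injective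

lemma range_incl (ν : ℕ → ℕ) : Set.range (B.incl ν) = {z | B.q ν z < ∞} :=
  Subtype.range_coe

/-! ### Completeness and compactness -/

lemma eventually_q_incl_sub_le {u : ℕ → B.Space ν} (hu : CauchySeq u) {z : E}
    (hz : Tendsto (fun n => B.incl ν (u n)) atTop (𝓝 z)) {ε : ℝ} (hε : 0 < ε) :
    ∀ᶠ n in atTop, B.q ν (B.incl ν (u n) - z) ≤ ENNReal.ofReal ε := by
  obtain ⟨N, hN⟩ := Metric.cauchySeq_iff.1 hu ε hε
  filter_upwards [eventually_ge_atTop N] with n hn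
  refine ((B.lowerSemicontinuous_q ν).isClosed_preimage (ENNReal.ofReal ε)).mem_of_tendsto
    (tendsto_const_nhds.sub hz) ?_
  filter_upwards [eventually_ge_atTop N] with m hm
  have dist_le := (hN n hn m hm).le
  rw [dist_eq_norm, norm_eq, ← ENNReal.le_ofReal_iff_toReal_le (B.q_incl_ne_top ν _) hε.le,
    map_sub] at dist_le
  exact dist_le

lemma completeSpace [CompleteSpace E] (hν : StrictMono ν) (h0 : ν 0 = 0) :
    CompleteSpace (B.Space ν) := by
  refine Metric.complete_of_cauchySeq_tendsto fun u hu => ?_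
  obtain ⟨z, hz⟩ := cauchySeq_tendsto_of_complete
    ((B.inclL hν h0).uniformContinuous.comp_cauchySeq hu)
  obtain ⟨w, rfl⟩ : z ∈ Set.range (B.incl ν) := by
    obtain ⟨n, hn⟩ := (B.eventually_q_incl_sub_le hu hz one_pos).exists
    obtain ⟨v, hv⟩ : B.incl ν (u n) - z ∈ Set.range (B.incl ν) :=
      B.range_incl ν ▸ hn.trans_lt ENNReal.ofReal_lt_top
    exact ⟨u n - v, by rw [map_sub, hv, sub_sub_cancel]⟩
  refine ⟨w, Metric.tendsto_nhds.2 fun ε hε => ?_⟩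
  filter_upwards [B.eventually_q_incl_sub_le hu hz (half_pos hε)] with n hn
  rw [dist_eq_norm, norm_eq, map_sub]
  exact (ENNReal.toReal_le_of_le_ofReal (half_pos hε).le hn).trans_lt (half_lt_self hε)

lemma isCompactOperator_proj (n : ℕ) : IsCompactOperator (B.proj n) :=
  Submodule.sum_mem (compactOperator (RingHom.id ℝ) E H) fun k _ =>
    (isCompactOperator_of_locallyCompactSpace_rng
      (ContinuousLinearMap.toSpanSingleton ℝ (dualToH i (B.e k)))).comp_clm (B.e k)

lemma isCompactOperator_incl [CompleteSpace E] (hν : StrictMono ν) (h0 : ν 0 = 0) :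
    IsCompactOperator (B.incl ν) := by
  have tendsto_sqrt : Tendsto (fun m : ℕ => √(2 * (1 / 2) ^ m)) atTop (𝓝 0) := by
    simpa using ((tendsto_pow_atTop_nhds_zero_of_lt_one (r := (1 / 2 : ℝ)) (by norm_num)
      (by norm_num)).const_mul 2).sqrt
  have tendsto_inclL : Tendsto (fun m => (i ∘L B.proj (ν m)) ∘L B.inclL hν h0) atTop
      (𝓝 (B.inclL hν h0)) := by
    refine tendsto_iff_norm_sub_tendsto_zero.2
      (squeeze_zero (fun _ => norm_nonneg _) (fun m => ?_) tendsto_sqrt)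
    rw [norm_sub_rev]
    exact ContinuousLinearMap.opNorm_le_bound _ (Real.sqrt_nonneg _) fun z =>
      B.norm_incl_sub_proj_le hν h0 z m
  exact isCompactOperator_of_tendsto tendsto_inclL (Eventually.of_forall fun m =>
    ((B.isCompactOperator_proj (ν m)).clm_comp i).comp_clm (B.inclL hν h0))

end CarmonaBasis

namespace CarmonaBasis

/-! ### The embedding of `H` into `E_x` -/

variable {H E : Type*} [NormedAddCommGroup H] [InnerProductSpace ℝ H] [CompleteSpace H]
  [NormedAddCommGroup E] [NormedSpace ℝ E] {i : H →L[ℝ] E} {x : E} (B : CarmonaBasis i x)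
  {ν : ℕ → ℕ}

lemma incr_sub_proj (hν : Monotone ν) (m n : ℕ) (z : E) :
    B.incr ν n (z - i (B.proj (ν m) z)) = if n < m then 0 else B.incr ν n z := by
  simp only [incr_apply, map_sub, proj_proj]
  split_ifs with h
  · rw [min_eq_left (hν h), min_eq_left (hν h.le)]
    abel
  · rw [not_lt] at h
    rw [min_eq_right (hν (h.trans n.le_succ)), min_eq_right (hν h)]
    abel

lemma e_sub_proj (m n : ℕ) (z : E) :
    B.e n (z - i (B.proj m z)) = if n < m then 0 else B.e n z := by
  rw [map_sub, e_proj]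
  split_ifs <;> simp

lemma tendsto_q_sub_proj (hν : StrictMono ν) {z : E} (hz : B.q ν z ≠ ∞) :
    Tendsto (fun m => B.q ν (z - i (B.proj (ν m) z))) atTop (𝓝 0) := by
  obtain ⟨tsum_incr_ne_top, tsum_e_ne_top⟩ :=
    ENNReal.add_ne_top.1 (B.q_sq ν z ▸ ENNReal.pow_ne_top hz (n := 2))
  have tendsto_incr : Tendsto (fun m => ∑' n : ℕ, (2 : ℝ≥0∞) ^ n *
      ‖B.incr ν n (z - i (B.proj (ν m) z))‖ₑ ^ 2) atTop (𝓝 0) := by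
    refine (tendsto_tsum_tail tsum_incr_ne_top).congr fun m => tsum_congr fun n => ?_
    rw [B.incr_sub_proj hν.monotone]
    split_ifs <;> simp
  have tendsto_e : Tendsto (fun m => ∑' n : ℕ, (2 : ℝ≥0∞) ^ (-(((n : ℝ) + 1) / 2)) *
      ‖B.e n (z - i (B.proj (ν m) z))‖ₑ) atTop (𝓝 0) := by
    refine ((tendsto_tsum_tail (by simpa using tsum_e_ne_top)).comp hν.tendsto_atTop).congr
      fun m => tsum_congr fun n => ?_
    rw [e_sub_proj]
    split_ifs <;> simp
  have tendsto_rpow := ((ENNReal.continuous_rpow_const (y := 1 / 2)).tendsto _).comp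
    (tendsto_incr.add (((ENNReal.continuous_pow 2).tendsto _).comp tendsto_e))
  simpa [q, incr_apply, Function.comp_def] using tendsto_rpow

lemma enorm_incr_apply_le (hν : Monotone ν) (n : ℕ) (h : H) :
    ‖B.incr ν n (i h)‖ₑ ≤ ‖i‖ₑ * ‖h‖ₑ := by
  rw [incr_apply, ← map_sub]
  exact i.le_opENorm_of_le
    (enorm_le_iff_norm_le.2 (B.norm_proj_sub_proj_le (hν n.le_succ) h))

lemma tsum_enorm_e_sq_le (h : H) : ∑' n, ‖B.e n (i h)‖ₑ ^ 2 ≤ ‖h‖ₑ ^ 2 := by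
  have bessel := ENNReal.ofReal_le_ofReal (B.orthonormal.tsum_inner_products_le h)
  rw [ENNReal.ofReal_tsum_of_nonneg (fun _ => by positivity)
    (B.orthonormal.inner_products_summable h)] at bessel
  simpa only [inner_dualToH, ENNReal.ofReal_pow (norm_nonneg _), ofReal_norm] using bessel

lemma tsum_e_apply_sq_le (h : H) :
    (∑' n : ℕ, (2 : ℝ≥0∞) ^ (-(((n : ℝ) + 1) / 2)) * ‖B.e n (i h)‖ₑ) ^ 2 ≤ ‖h‖ₑ ^ 2 := by
  refine (tsum_mul_sq_le _ _).trans ?_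
  simp only [two_rpow_neg_half_sq]
  rw [tsum_inv_two_pow_succ, one_mul]
  exact B.tsum_enorm_e_sq_le h

namespace IsAdmissible

variable [MeasurableSpace E] {μ : Measure E} {B}

-- `P̃_{ν (n+1)}` kills `g = (P̃_{ν (n+2)} - P̃_{ν (n+1)}) h`, so the increment at `h` is the
-- remainder `(Id - Q̃_{n+1}) g`, which the admissibility bound controls.
lemma enorm_incr_succ_apply_le (hν : B.IsAdmissible μ ν) (n : ℕ) (h : H) :
    ‖B.incr ν (n + 1) (i h)‖ₑ ≤ 2⁻¹ ^ (n + 1) * ‖h‖ₑ := by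
  have hν_le : ν (n + 1) ≤ ν (n + 2) := hν.strictMono.monotone (Nat.le_succ _)
  let g : H := B.proj (ν (n + 2)) (i h) - B.proj (ν (n + 1)) (i h)
  have proj_g : B.proj (ν (n + 1)) (i g) = 0 := by
    simp only [g, map_sub, proj_proj, min_eq_left hν_le, min_self, sub_self]
  have incr_eq : B.incr ν (n + 1) (i h) = (i - (i ∘L B.proj (ν (n + 1))) ∘L i) g := by
    rw [sub_apply, ContinuousLinearMap.comp_apply,
      ContinuousLinearMap.comp_apply, proj_g, map_zero, sub_zero, map_sub, incr_apply]
  have opENorm_le : ‖i - (i ∘L B.proj (ν (n + 1))) ∘L i‖ₑ ≤ 2⁻¹ ^ (n + 1) := by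
    rw [← ofReal_norm]
    refine (ENNReal.ofReal_le_ofReal (hν.opNorm_le (n + 1) (by omega))).trans_eq ?_
    rw [ENNReal.ofReal_pow (by positivity), one_div, ENNReal.ofReal_inv_of_pos two_pos,
      ENNReal.ofReal_ofNat]
  rw [incr_eq]
  refine (ContinuousLinearMap.le_opENorm _ g).trans (mul_le_mul' opENorm_le ?_)
  exact enorm_le_iff_norm_le.2 (B.norm_proj_sub_proj_le hν_le h)

lemma tsum_incr_apply_sq_le (hν : B.IsAdmissible μ ν) (h : H) :
    ∑' n : ℕ, (2 : ℝ≥0∞) ^ n * ‖B.incr ν n (i h)‖ₑ ^ 2 ≤ (‖i‖ₑ ^ 2 + 1) * ‖h‖ₑ ^ 2 := by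
  rw [tsum_eq_zero_add' ENNReal.summable, add_mul, pow_zero, one_mul, ← mul_pow]
  gcongr
  · exact B.enorm_incr_apply_le hν.strictMono.monotone 0 h
  · rw [← tsum_inv_two_pow_succ, ← ENNReal.tsum_mul_right]
    refine ENNReal.tsum_le_tsum fun n => ?_
    calc (2 : ℝ≥0∞) ^ (n + 1) * ‖B.incr ν (n + 1) (i h)‖ₑ ^ 2
        ≤ 2 ^ (n + 1) * (2⁻¹ ^ (n + 1) * ‖h‖ₑ) ^ 2 := by
          gcongr
          exact hν.enorm_incr_succ_apply_le n h
      _ = 2⁻¹ ^ (n + 1) * 2 ^ (n + 1) * (2⁻¹ ^ (n + 1) * ‖h‖ₑ ^ 2) := by ring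
      _ = 2⁻¹ ^ (n + 1) * ‖h‖ₑ ^ 2 := by rw [inv_two_pow_mul_two_pow, one_mul]

lemma q_apply_le (hν : B.IsAdmissible μ ν) (h : H) :
    B.q ν (i h) ≤ ENNReal.ofReal (√(2 + ‖i‖ ^ 2) * ‖h‖) := by
  refine (ENNReal.pow_le_pow_left_iff two_ne_zero).1 ?_
  calc B.q ν (i h) ^ 2
      ≤ (‖i‖ₑ ^ 2 + 1) * ‖h‖ₑ ^ 2 + ‖h‖ₑ ^ 2 := by
        rw [q_sq]
        exact add_le_add (hν.tsum_incr_apply_sq_le h) (B.tsum_e_apply_sq_le h)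
    _ = (2 + ‖i‖ₑ ^ 2) * ‖h‖ₑ ^ 2 := by ring
    _ = ENNReal.ofReal (√(2 + ‖i‖ ^ 2) * ‖h‖) ^ 2 := by
        rw [← ENNReal.ofReal_pow (by positivity), mul_pow, Real.sq_sqrt (by positivity),
          ENNReal.ofReal_mul (by positivity), ENNReal.ofReal_add zero_le_two (by positivity),
          ENNReal.ofReal_pow (norm_nonneg _), ENNReal.ofReal_pow (norm_nonneg _), ofReal_norm,
          ofReal_norm, ENNReal.ofReal_ofNat]

lemma q_apply_le_of_norm_le_one (hν : B.IsAdmissible μ ν) (hi : ‖i‖ ≤ 1) (h : H) :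
    B.q ν (i h) ≤ ENNReal.ofReal (√3 * ‖h‖) := by
  refine (hν.q_apply_le h).trans (ENNReal.ofReal_le_ofReal ?_)
  gcongr
  nlinarith [norm_nonneg i]

/-- The embedding of `H` into `E_x`, continuous for the norm `q_x` of `E_x`. -/
def embedding (hν : B.IsAdmissible μ ν) : H →L[ℝ] B.Space ν :=
  LinearMap.mkContinuous (F := B.Space ν)
    ((i : H →ₗ[ℝ] E).codRestrict (B.subspace ν)
      fun h => (hν.q_apply_le h).trans_lt ENNReal.ofReal_lt_top)
    √(2 + ‖i‖ ^ 2)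
    fun h => ENNReal.toReal_le_of_le_ofReal (by positivity) (hν.q_apply_le h)

lemma incl_embedding (hν : B.IsAdmissible μ ν) (h : H) : B.incl ν (hν.embedding h) = i h := rfl

lemma embedding_injective (hν : B.IsAdmissible μ ν) (hi : Function.Injective i) :
    Function.Injective hν.embedding :=
  .of_comp (f := B.incl ν) hi

lemma tendsto_embedding_proj (hν : B.IsAdmissible μ ν) (z : B.Space ν) :
    Tendsto (fun m => hν.embedding (B.proj (ν m) (B.incl ν z))) atTop (𝓝 z) := by
  rw [tendsto_iff_norm_sub_tendsto_zero]
  refine ((ENNReal.tendsto_toReal ENNReal.zero_ne_top).comp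
    (B.tendsto_q_sub_proj hν.strictMono (B.q_incl_ne_top ν z))).congr fun m => ?_
  rw [Function.comp_apply, norm_sub_rev, norm_eq, map_sub, incl_embedding]

lemma denseRange_embedding (hν : B.IsAdmissible μ ν) : DenseRange hν.embedding := fun z =>
  mem_closure_of_tendsto (hν.tendsto_embedding_proj z)
    (Eventually.of_forall fun _ => Set.mem_range_self _)

end IsAdmissible

end CarmonaBasis

section Moments

/-! ### Second moments -/

lemma tsum_fernique_ne_top {c : ℝ≥0∞} (hc : 2⁻¹ < c) (hc' : c < 1) :
    ∑' n : ℕ, ENNReal.ofReal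
      (Real.exp (-2⁻¹ * Real.log (c / (1 - c)).toReal * 2 ^ n)) ≠ ∞ := by
  have log_pos : 0 < Real.log (c / (1 - c)).toReal := by
    rw [ENNReal.toReal_div]
    exact (div_pos_iff_of_pos_right (by positivity)).1 (Fernique.logRatio_pos hc hc')
  exact (Real.summable_exp_nat_mul_of_ge (mul_neg_of_neg_of_pos (by norm_num) log_pos)
    fun n => mod_cast (Nat.lt_pow_self one_lt_two).le).tsum_ofReal_lt_top.ne

lemma exists_lintegral_enorm_sq_le (E : Type*) [NormedAddCommGroup E] [NormedSpace ℝ E]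
    [MeasurableSpace E] [BorelSpace E] [SecondCountableTopology E] [CompleteSpace E]
    {c : ℝ≥0∞} (hc : 2⁻¹ < c) (hc' : c < 1) :
    ∃ C : ℝ≥0∞, C ≠ ∞ ∧ ∀ (ρ : Measure E) [IsGaussian ρ], (∀ l : StrongDual ℝ E, ρ[l] = 0) →
      ∀ a : ℝ, 0 < a → c ≤ ρ {z | ‖z‖ ≤ a} →
        ∫⁻ z, ‖z‖ₑ ^ 2 ∂ρ ≤ C * ENNReal.ofReal a ^ 2 := by
  let K := Fernique.logRatio c
  have K_pos : 0 < K := Fernique.logRatio_pos hc hc'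
  let L : ℝ≥0∞ := ENNReal.ofReal (Real.exp K) +
    ∑' n : ℕ, ENNReal.ofReal (Real.exp (-2⁻¹ * Real.log (c / (1 - c)).toReal * 2 ^ n))
  have L_ne_top : L ≠ ∞ :=
    ENNReal.add_ne_top.2 ⟨ENNReal.ofReal_ne_top, tsum_fernique_ne_top hc hc'⟩
  refine ⟨ENNReal.ofReal K⁻¹ * L, ENNReal.mul_ne_top ENNReal.ofReal_ne_top L_ne_top,
    fun ρ _ hρ a ha h => ?_⟩
  have fernique : ∫⁻ z, ENNReal.ofReal (Real.exp (K * a⁻¹ ^ 2 * ‖z‖ ^ 2)) ∂ρ ≤ L :=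
    lintegral_exp_mul_sq_norm_le_of_map_rotation_eq_self
      (IsGaussian.map_rotation_eq_self_of_forall_strongDual_eq_zero hρ _) h hc
  have sq_le_exp (r : ℝ) : r ^ 2 ≤ K⁻¹ * a ^ 2 * Real.exp (K * a⁻¹ ^ 2 * r ^ 2) :=
    calc r ^ 2 = K⁻¹ * a ^ 2 * (K * a⁻¹ ^ 2 * r ^ 2) := by field_simp
      _ ≤ _ := by
        gcongr
        exact (lt_add_one _).le.trans (Real.add_one_le_exp _)
  calc ∫⁻ z, ‖z‖ₑ ^ 2 ∂ρ
      ≤ ∫⁻ z, ENNReal.ofReal (K⁻¹ * a ^ 2) *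
          ENNReal.ofReal (Real.exp (K * a⁻¹ ^ 2 * ‖z‖ ^ 2)) ∂ρ := by
        refine lintegral_mono fun z => ?_
        rw [← ENNReal.ofReal_mul (by positivity), ← ofReal_norm,
          ← ENNReal.ofReal_pow (norm_nonneg _)]
        exact ENNReal.ofReal_le_ofReal (sq_le_exp ‖z‖)
    _ = ENNReal.ofReal (K⁻¹ * a ^ 2) *
          ∫⁻ z, ENNReal.ofReal (Real.exp (K * a⁻¹ ^ 2 * ‖z‖ ^ 2)) ∂ρ :=
        lintegral_const_mul _ (by fun_prop)
    _ ≤ ENNReal.ofReal (K⁻¹ * a ^ 2) * L := by gcongr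
    _ = ENNReal.ofReal K⁻¹ * L * ENNReal.ofReal a ^ 2 := by
        rw [ENNReal.ofReal_mul (by positivity), ENNReal.ofReal_pow ha.le]
        ring

lemma lintegral_enorm_sq_ne_top {α F : Type*} [MeasurableSpace α] [NormedAddCommGroup F]
    {μ : Measure α} {f : α → F} (hf : MemLp f 2 μ) : ∫⁻ z, ‖f z‖ₑ ^ 2 ∂μ ≠ ∞ := by
  simpa using (lintegral_rpow_enorm_lt_top_of_eLpNorm_lt_top two_ne_zero
    ENNReal.ofNat_ne_top hf.2).ne

lemma one_sub_le_measure_norm_le {E : Type*} [NormedAddCommGroup E] [MeasurableSpace E]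
    [OpensMeasurableSpace E] {ρ : Measure E} [IsProbabilityMeasure ρ] {a : ℝ} {δ : ℝ≥0∞}
    (h : ρ {z | a < ‖z‖} ≤ δ) : 1 - δ ≤ ρ {z | ‖z‖ ≤ a} := by
  have compl_eq : {z : E | ‖z‖ ≤ a} = {z | a < ‖z‖}ᶜ := by
    ext
    simp
  rw [compl_eq, prob_compl_eq_one_sub (measurableSet_lt measurable_const measurable_norm)]
  exact tsub_le_tsub_left h 1

lemma tsum_two_rpow_ne_top : ∑' n : ℕ, (2 : ℝ≥0∞) ^ (-(((n : ℝ) + 1) / 2)) ≠ ∞ := by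
  have eq_geometric (n : ℕ) :
      (2 : ℝ≥0∞) ^ (-(((n : ℝ) + 1) / 2)) = ((2 : ℝ≥0∞) ^ (-(1 / 2 : ℝ))) ^ (n + 1) := by
    rw [← ENNReal.rpow_natCast, ← ENNReal.rpow_mul]
    congr 1
    push_cast
    ring
  have ratio_lt_one : (2 : ℝ≥0∞) ^ (-(1 / 2 : ℝ)) < 1 :=
    ENNReal.rpow_lt_one_of_one_lt_of_neg (by norm_num) (by norm_num)
  rw [tsum_congr eq_geometric, ENNReal.tsum_geometric_add_one]
  exact ENNReal.mul_ne_top ratio_lt_one.ne_top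
    (ENNReal.inv_ne_top.2 (tsub_pos_of_lt ratio_lt_one).ne')

variable {H E : Type*} [NormedAddCommGroup H] [InnerProductSpace ℝ H] [CompleteSpace H]
  [NormedAddCommGroup E] [NormedSpace ℝ E] {i : H →L[ℝ] E} {x : E} {B : CarmonaBasis i x}
  {ν : ℕ → ℕ} [MeasurableSpace E] {μ : Measure E}

lemma CarmonaBasis.IsAdmissible.measure_lt_norm_incr_le (hν : B.IsAdmissible μ ν) {n : ℕ}
    (hn : 1 ≤ n) : μ {z | 2 * (1 / 2 : ℝ) ^ n < ‖B.incr ν n z‖} ≤ 2 * (1 / 2) ^ n := by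
  have subset_union : {z | 2 * (1 / 2 : ℝ) ^ n < ‖B.incr ν n z‖} ⊆
      {z | (1 / 2 : ℝ) ^ (n + 1) < ‖z - i (B.proj (ν (n + 1)) z)‖} ∪
        {z | (1 / 2 : ℝ) ^ n < ‖z - i (B.proj (ν n) z)‖} := by
    intro z (hz : 2 * (1 / 2 : ℝ) ^ n < ‖B.incr ν n z‖)
    by_contra hz_union
    simp only [Set.mem_union, Set.mem_ofPred_eq, not_or, not_lt] at hz_union
    have norm_incr_le : ‖B.incr ν n z‖ ≤
        ‖z - i (B.proj (ν n) z)‖ + ‖z - i (B.proj (ν (n + 1)) z)‖ := by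
      rw [B.incr_apply, ← sub_sub_sub_cancel_left _ _ z]
      exact norm_sub_le _ _
    have pow_succ_le : (1 / 2 : ℝ) ^ (n + 1) ≤ (1 / 2) ^ n :=
      pow_le_pow_of_le_one (by norm_num) (by norm_num) n.le_succ
    linarith [hz_union.1, hz_union.2]
  calc μ {z | 2 * (1 / 2 : ℝ) ^ n < ‖B.incr ν n z‖}
      ≤ (1 / 2) ^ (n + 1) + (1 / 2) ^ n :=
        (measure_mono subset_union).trans ((measure_union_le _ _).trans
          (add_le_add (hν.measure_le (n + 1) (by omega)) (hν.measure_le n hn)))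
    _ ≤ (1 / 2) ^ n + (1 / 2) ^ n := by
        gcongr ?_ + _
        exact pow_le_pow_of_le_one zero_le (by simp) n.le_succ
    _ = 2 * (1 / 2) ^ n := (two_mul _).symm

variable [BorelSpace E]

lemma CarmonaBasis.measurable_q (B : CarmonaBasis i x) (ν : ℕ → ℕ) : Measurable (B.q ν) :=
  (B.lowerSemicontinuous_q ν).measurable

lemma CarmonaBasis.measurableSet_q_lt_top (B : CarmonaBasis i x) (ν : ℕ → ℕ) :
    MeasurableSet {z | B.q ν z < ∞} :=
  measurableSet_lt (B.measurable_q ν) measurable_const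

namespace IsAbstractWienerSpace

-- The increment is at most `2 * 2⁻ⁿ` off an event of probability `≤ 1 / 4`, so Fernique's theorem
-- bounds its second moment by a multiple of `4⁻ⁿ`, which beats the weight `2ⁿ`.
lemma exists_two_pow_mul_lintegral_incr_le (hW : IsAbstractWienerSpace i μ)
    (hν : B.IsAdmissible μ ν) :
    ∃ C : ℝ≥0∞, C ≠ ∞ ∧ ∀ n, 3 ≤ n →
      2 ^ n * ∫⁻ z, ‖B.incr ν n z‖ₑ ^ 2 ∂μ ≤ C * 2⁻¹ ^ n := by
  have := hW.isGaussian
  have := hW.secondCountable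
  have := hW.complete
  have half_lt : (2 : ℝ≥0∞)⁻¹ < 1 - 1 / 4 := by
    rw [← ENNReal.toReal_lt_toReal (by simp) (by finiteness),
      ENNReal.toReal_sub_of_le (by simp) (by simp)]
    norm_num
  obtain ⟨C, C_ne_top, fernique⟩ := exists_lintegral_enorm_sq_le E half_lt
    (ENNReal.sub_lt_self ENNReal.one_ne_top one_ne_zero (by simp))
  refine ⟨4 * C, ENNReal.mul_ne_top ENNReal.ofNat_ne_top C_ne_top, fun n hn => ?_⟩
  have : IsProbabilityMeasure (μ.map (B.incr ν n)) := Measure.isProbabilityMeasure_map (by fun_prop)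
  have measure_le : μ.map (B.incr ν n) {z | 2 * (1 / 2 : ℝ) ^ n < ‖z‖} ≤ 1 / 4 := by
    rw [Measure.map_apply (by fun_prop) (measurableSet_lt measurable_const measurable_norm)]
    calc μ {z | 2 * (1 / 2 : ℝ) ^ n < ‖B.incr ν n z‖}
        ≤ 2 * (1 / 2) ^ n := hν.measure_lt_norm_incr_le (by omega)
      _ ≤ 2 * (1 / 2) ^ 3 := by
          gcongr 2 * ?_
          exact pow_le_pow_of_le_one zero_le (by simp) hn
      _ = 1 / 4 := by
          rw [← ENNReal.toReal_eq_toReal_iff' (by finiteness) (by finiteness)]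
          norm_num
  have lintegral_le : ∫⁻ z, ‖B.incr ν n z‖ₑ ^ 2 ∂μ ≤
      C * ENNReal.ofReal (2 * (1 / 2 : ℝ) ^ n) ^ 2 := by
    have h := fernique (μ.map (B.incr ν n)) (fun l => by
      rw [integral_map (by fun_prop) (by fun_prop)]
      exact hW.integral_dual_eq_zero (l ∘L B.incr ν n)) _ (by positivity)
      (one_sub_le_measure_norm_le measure_le)
    rwa [lintegral_map (by fun_prop) (by fun_prop)] at h
  calc 2 ^ n * ∫⁻ z, ‖B.incr ν n z‖ₑ ^ 2 ∂μ
      ≤ 2 ^ n * (C * (2 * 2⁻¹ ^ n) ^ 2) := by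
        gcongr
        rwa [ENNReal.ofReal_mul zero_le_two, ENNReal.ofReal_pow (by norm_num), one_div,
          ENNReal.ofReal_inv_of_pos two_pos, ENNReal.ofReal_ofNat] at lintegral_le
    _ = 4 * C * (2⁻¹ ^ n * 2 ^ n) * 2⁻¹ ^ n := by ring
    _ = 4 * C * 2⁻¹ ^ n := by rw [inv_two_pow_mul_two_pow, mul_one]

lemma tsum_lintegral_incr_ne_top (hW : IsAbstractWienerSpace i μ) (hν : B.IsAdmissible μ ν) :
    ∑' n : ℕ, 2 ^ n * ∫⁻ z, ‖B.incr ν n z‖ₑ ^ 2 ∂μ ≠ ∞ := by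
  have := hW.isGaussian
  have := hW.secondCountable
  have := hW.complete
  obtain ⟨C, C_ne_top, lintegral_le⟩ := hW.exists_two_pow_mul_lintegral_incr_le hν
  rw [← Summable.sum_add_tsum_nat_add' (k := 3) ENNReal.summable]
  refine ENNReal.add_ne_top.2 ⟨ENNReal.sum_ne_top.2 fun n _ => ENNReal.mul_ne_top (by simp)
    (lintegral_enorm_sq_ne_top ((B.incr ν n).comp_memLp' IsGaussian.memLp_two_id)),
    ne_top_of_le_ne_top ?_ (ENNReal.tsum_le_tsum fun n => lintegral_le (n + 3) (by omega))⟩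
  simp only [pow_add, ENNReal.tsum_mul_left, ENNReal.tsum_mul_right, ENNReal.tsum_geometric_two]
  finiteness

lemma lintegral_e_sq (hW : IsAbstractWienerSpace i μ) (B : CarmonaBasis i x) (n : ℕ) :
    ∫⁻ z, ‖B.e n z‖ₑ ^ 2 ∂μ = ∫⁻ y, ‖y‖ₑ ^ 2 ∂(gaussianReal 0 1) := by
  have map_e : μ.map (B.e n) = gaussianReal 0 1 := by
    rw [hW.gaussian, B.orthonormal.nnnorm_eq_one n, one_pow]
  rw [← map_e, lintegral_map (by fun_prop) (by fun_prop)]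

lemma lintegral_tsum_e_sq_ne_top (hW : IsAbstractWienerSpace i μ) (B : CarmonaBasis i x) :
    ∫⁻ z, (∑' n : ℕ, (2 : ℝ≥0∞) ^ (-(((n : ℝ) + 1) / 2)) * ‖B.e n z‖ₑ) ^ 2 ∂μ ≠ ∞ := by
  refine ne_top_of_le_ne_top ?_ (lintegral_mono fun z => tsum_weight_mul_sq_le _ _)
  rw [lintegral_const_mul _ (by fun_prop), lintegral_tsum (by fun_prop)]
  refine ENNReal.mul_ne_top tsum_two_rpow_ne_top ?_
  have lintegral_term (n : ℕ) :
      ∫⁻ z, (2 : ℝ≥0∞) ^ (-(((n : ℝ) + 1) / 2)) * ‖B.e n z‖ₑ ^ 2 ∂μ =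
        2 ^ (-(((n : ℝ) + 1) / 2)) * ∫⁻ y, ‖y‖ₑ ^ 2 ∂(gaussianReal 0 1) := by
    rw [lintegral_const_mul _ (by fun_prop), hW.lintegral_e_sq]
  rw [tsum_congr lintegral_term, ENNReal.tsum_mul_right]
  exact ENNReal.mul_ne_top tsum_two_rpow_ne_top (lintegral_enorm_sq_ne_top IsGaussian.memLp_two_id)

lemma lintegral_q_sq_ne_top (hW : IsAbstractWienerSpace i μ) (hν : B.IsAdmissible μ ν) :
    ∫⁻ z, B.q ν z ^ 2 ∂μ ≠ ∞ := by
  simp only [CarmonaBasis.q_sq]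
  rw [lintegral_add_left (by fun_prop), lintegral_tsum (by fun_prop),
    tsum_congr fun n => lintegral_const_mul _ (by fun_prop)]
  exact ENNReal.add_ne_top.2
    ⟨hW.tsum_lintegral_incr_ne_top hν, hW.lintegral_tsum_e_sq_ne_top B⟩

lemma memLp_q (hW : IsAbstractWienerSpace i μ) (hν : B.IsAdmissible μ ν) :
    MemLp (B.q ν) 2 μ := by
  refine ⟨(B.measurable_q ν).aestronglyMeasurable, ?_⟩
  rw [eLpNorm_lt_top_iff_lintegral_rpow_enorm_lt_top (by simp) (by simp)]
  simpa using (hW.lintegral_q_sq_ne_top hν).lt_top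

lemma ae_q_lt_top (hW : IsAbstractWienerSpace i μ) (hν : B.IsAdmissible μ ν) :
    ∀ᵐ z ∂μ, B.q ν z < ∞ := by
  filter_upwards [ae_lt_top ((B.measurable_q ν).pow_const 2) (hW.lintegral_q_sq_ne_top hν)]
    with z hz
  exact (ENNReal.pow_lt_top_iff.1 hz).resolve_right two_ne_zero

lemma measure_q_lt_top (hW : IsAbstractWienerSpace i μ) (hν : B.IsAdmissible μ ν) :
    μ {z | B.q ν z < ∞} = 1 := by
  have := hW.isGaussian
  exact (prob_compl_eq_zero_iff (B.measurableSet_q_lt_top ν)).1 (hW.ae_q_lt_top hν)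

end IsAbstractWienerSpace

end Moments

section WienerSpaceOfQ

/-! ### `(E_x, H, μ)` as an abstract Wiener space -/

lemma tendsto_charFunDual {F : Type*} [NormedAddCommGroup F] [NormedSpace ℝ F]
    [MeasurableSpace F] [OpensMeasurableSpace F] (ρ : Measure F) [IsFiniteMeasure ρ]
    {l : ℕ → StrongDual ℝ F} {l' : StrongDual ℝ F}
    (h : ∀ w, Tendsto (fun m => l m w) atTop (𝓝 (l' w))) :
    Tendsto (fun m => charFunDual ρ (l m)) atTop (𝓝 (charFunDual ρ l')) := by
  simp only [charFunDual_apply]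
  have continuous_cexp : Continuous fun r : ℝ => Complex.exp ((r : ℂ) * Complex.I) := by fun_prop
  exact tendsto_integral_of_dominated_convergence (fun _ => 1)
    (fun m => (continuous_cexp.measurable.comp (l m).continuous.measurable).aestronglyMeasurable)
    (integrable_const 1)
    (fun m => Eventually.of_forall fun w => (Complex.norm_exp_ofReal_mul_I _).le)
    (Eventually.of_forall fun w => (continuous_cexp.tendsto _).comp (h w))

variable {H E : Type*} [NormedAddCommGroup H] [InnerProductSpace ℝ H] [CompleteSpace H]
  [NormedAddCommGroup E] [NormedSpace ℝ E] [MeasurableSpace E]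

lemma map_eq_gaussianReal_of_charFunDual [OpensMeasurableSpace E] {j : H →L[ℝ] E} {ρ : Measure E}
    [IsFiniteMeasure ρ]
    (h : ∀ l : StrongDual ℝ E, charFunDual ρ l = Complex.exp (-(‖dualToH j l‖ : ℂ) ^ 2 / 2))
    (l : StrongDual ℝ E) : ρ.map l = gaussianReal 0 (‖dualToH j l‖₊ ^ 2) := by
  refine Measure.ext_of_charFun (funext fun t => ?_)
  have norm_sq_dualToH_smul : ‖dualToH j (t • l)‖ ^ 2 = t ^ 2 * ‖dualToH j l‖ ^ 2 := by
    rw [show dualToH j (t • l) = t • dualToH j l from (dualToHₗ j).map_smul t l, norm_smul,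
      mul_pow, Real.norm_eq_abs, sq_abs]
  rw [charFun_map_eq_charFunDual_smul, h, charFun_gaussianReal]
  congr 1
  rw [← Complex.ofReal_pow, norm_sq_dualToH_smul]
  simp only [Complex.ofReal_mul, Complex.ofReal_pow, Complex.ofReal_zero, mul_zero, zero_mul,
    NNReal.coe_pow, coe_nnnorm, zero_sub]
  ring

variable [BorelSpace E] {i : H →L[ℝ] E} {μ : Measure E} {x : E} {B : CarmonaBasis i x} {ν : ℕ → ℕ}

namespace IsAbstractWienerSpace

lemma secondCountableTopology_space (hW : IsAbstractWienerSpace i μ) (hν : B.IsAdmissible μ ν) :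
    SecondCountableTopology (B.Space ν) := by
  have := hW.separable
  have : TopologicalSpace.SeparableSpace (B.Space ν) :=
    hν.denseRange_embedding.separableSpace hν.embedding.continuous
  exact UniformSpace.secondCountable_of_separable _

lemma measurableEmbedding_incl (hW : IsAbstractWienerSpace i μ) (hν : B.IsAdmissible μ ν) :
    MeasurableEmbedding (B.incl ν) := by
  have := hW.complete
  have := B.completeSpace hν.strictMono hν.zero
  have := hW.secondCountable
  have := hW.secondCountableTopology_space hν
  exact (B.inclL hν.strictMono hν.zero).continuous.measurableEmbedding (B.incl_injective ν)

lemma map_incl_comap_incl (hW : IsAbstractWienerSpace i μ) (hν : B.IsAdmissible μ ν) :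
    (μ.comap (B.incl ν)).map (B.incl ν) = μ := by
  rw [(hW.measurableEmbedding_incl hν).map_comap, B.range_incl]
  exact Measure.restrict_eq_self_of_ae_mem (hW.ae_q_lt_top hν)

lemma isProbabilityMeasure_comap_incl (hW : IsAbstractWienerSpace i μ)
    (hν : B.IsAdmissible μ ν) : IsProbabilityMeasure (μ.comap (B.incl ν)) := by
  have := hW.isGaussian
  refine (hW.measurableEmbedding_incl hν).isProbabilityMeasure_comap ?_
  rw [B.range_incl]
  exact hW.ae_q_lt_top hν

-- A functional `l` on `E_x` is the pointwise limit of `z ↦ l (Q̃_m z)`, and these extend to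
-- elements of `E'`, whose characteristic functionals under `μ` are known.
lemma charFunDual_comap_incl (hW : IsAbstractWienerSpace i μ) (hν : B.IsAdmissible μ ν)
    (l : StrongDual ℝ (B.Space ν)) : charFunDual (μ.comap (B.incl ν)) l =
      Complex.exp (-(‖dualToH hν.embedding l‖ : ℂ) ^ 2 / 2) := by
  have := hW.complete
  have := hW.isProbabilityMeasure_comap_incl hν
  let lm (m : ℕ) : StrongDual ℝ E := (l ∘L hν.embedding) ∘L B.proj (ν m)
  have dualToH_lm (m : ℕ) :
      dualToH i (lm m) = B.proj (ν m) (i (dualToH hν.embedding l)) := by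
    refine ext_inner_right ℝ fun h => ?_
    rw [inner_dualToH, B.inner_proj_left, inner_dualToH]
    rfl
  have charFunDual_lm (m : ℕ) : charFunDual μ (lm m) =
      charFunDual (μ.comap (B.incl ν)) (lm m ∘L B.inclL hν.strictMono hν.zero) := by
    conv_lhs => rw [← hW.map_incl_comap_incl hν]
    exact charFunDual_map (B.inclL hν.strictMono hν.zero) (lm m)
  have tendsto_charFunDual_lm : Tendsto (fun m => charFunDual μ (lm m)) atTop
      (𝓝 (charFunDual (μ.comap (B.incl ν)) l)) := by
    simp only [charFunDual_lm]
    exact tendsto_charFunDual _ fun w =>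
      (l.continuous.tendsto w).comp (hν.tendsto_embedding_proj w)
  have tendsto_norm : Tendsto (fun m => ‖B.proj (ν m) (i (dualToH hν.embedding l))‖) atTop
      (𝓝 ‖dualToH hν.embedding l‖) :=
    ((B.tendsto_proj _).comp hν.strictMono.tendsto_atTop).norm
  have continuous_cexp : Continuous fun r : ℝ => Complex.exp (-(r : ℂ) ^ 2 / 2) := by fun_prop
  refine tendsto_nhds_unique tendsto_charFunDual_lm ?_
  simp only [hW.charFunDual_eq, dualToH_lm]
  exact (continuous_cexp.tendsto _).comp tendsto_norm

lemma isAbstractWienerSpace_embedding (hW : IsAbstractWienerSpace i μ)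
    (hν : B.IsAdmissible μ ν) :
    IsAbstractWienerSpace hν.embedding (μ.comap (B.incl ν)) where
  separable := hW.separable
  complete :=
    have := hW.complete
    B.completeSpace hν.strictMono hν.zero
  injective := hν.embedding_injective hW.injective
  dense := hν.denseRange_embedding
  gaussian :=
    have := hW.isProbabilityMeasure_comap_incl hν
    map_eq_gaussianReal_of_charFunDual (hW.charFunDual_comap_incl hν)

end IsAbstractWienerSpace

end WienerSpaceOfQ

end AbstractWiener

end

theorem proposition2p3 {H E : Type*}
    [NormedAddCommGroup H] [InnerProductSpace ℝ H] [CompleteSpace H]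
    [NormedAddCommGroup E] [NormedSpace ℝ E] [MeasurableSpace E] [BorelSpace E]
    (i : H →L[ℝ] E) (μ : Measure E) (hW : AbstractWiener.IsAbstractWienerSpace i μ)
    (x : E) (hx : x ∉ Set.range i) :
    -- the data that enter the definition of `q_x` exist ...
    Nonempty (AbstractWiener.CarmonaBasis i x) ∧
    ∀ B : AbstractWiener.CarmonaBasis i x,
      (∃ ν : ℕ → ℕ, B.IsAdmissible μ ν) ∧
      -- ... and for every choice of them the following holds
      ∀ ν : ℕ → ℕ, B.IsAdmissible μ ν →
        -- `E_x` is Borel and has full measure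
        (MeasurableSet {z | B.q ν z < ∞} ∧ μ {z | B.q ν z < ∞} = 1) ∧
        -- bound on `H`
        ((∀ h : H, B.q ν (i h) ≤ ENNReal.ofReal (√(2 + ‖i‖ ^ 2) * ‖h‖)) ∧
          (‖i‖ ≤ 1 → ∀ h : H, B.q ν (i h) ≤ ENNReal.ofReal (√3 * ‖h‖))) ∧
        -- norm comparison, completeness, compact embedding
        ((∀ z : E, ‖z‖ₑ ≤ ENNReal.ofReal √2 * B.q ν z) ∧
          CompleteSpace (B.Space ν) ∧
          IsCompactOperator (B.incl ν)) ∧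
        -- `(E_x, H, μ)` is an abstract Wiener space and `q_x` is square integrable
        ((∃ j : H →L[ℝ] B.Space ν, (∀ h, B.incl ν (j h) = i h) ∧
            AbstractWiener.IsAbstractWienerSpace j (μ.comap (B.incl ν))) ∧
          MemLp (B.q ν) 2 μ) := by
  have := hW.separable
  have := hW.complete
  refine ⟨AbstractWiener.exists_carmonaBasis hW.injective hW.dense hx, fun B =>
    ⟨hW.exists_isAdmissible B, fun ν hν => ⟨?_, ?_, ?_, ?_, ?_⟩⟩⟩
  · exact ⟨B.measurableSet_q_lt_top ν, hW.measure_q_lt_top hν⟩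
  · exact ⟨hν.q_apply_le, hν.q_apply_le_of_norm_le_one⟩
  · exact ⟨B.enorm_le_q hν.strictMono hν.zero, B.completeSpace hν.strictMono hν.zero,
      B.isCompactOperator_incl hν.strictMono hν.zero⟩
  · exact ⟨hν.embedding, hν.incl_embedding, hW.isAbstractWienerSpace_embedding hν⟩
  · exact hW.memLp_q hν
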